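/- **Grid model.** Let $\mathcal V,\mathcal E,\mathcal D$ be finite sets of buses, AC branches and DC branches. AC branch $k$ has a source bus $\hat e(k)$ and a destination bus $\check e(k)$; DC branch $l$ has a source bus $\hat d(l)$ and a destination bus $\check d(l)$. An AC branch $k$ consists of an ideal transformer of complex ratio $\hat\rho_k\neq0$ at the source, a $\Pi$-circuit with series admittance $\bar y_k$ and shunt admittances $\hat y_k$ (source) and $\check y_k$ (destination), and an ideal transformer of ratio $\check\rho_k\neq 0$ at the destination. With $\rho_k=\hat\rho_k^*\check\rho_k$, $i=\hat e(k)$, $j=\check e(k)$, the branch currents at source and destination are $$\hat I_k=|\hat\rho_k|^2(\bar y_k+\hat y_k)v_i-\rho_k\bar y_kv_j,\qquad \check I_k=|\check\rho_k|^2(\bar y_k+\check y_k)v_j-\rho_k^*\bar y_kv_i .$$ Let $Y$ be the bus admittance matrix given by these branches and by bus shunt admittances $y_n\in\mathbb C$. Let $P_n,Q_n$ be the Hermitian matrices with $v^HP_nv+\mathrm i\,v^HQ_nv=v_n\,(Yv)_n^*$. For a DC branch with loss factor $\eta_l\in[0,1)$, $h_n\in\mathbb R^{\mathcal D}$ is the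 vector with $[h_n]_l=1_{\hat d(l)=n}-(1-\eta_l)1_{\check d(l)=n}$. The operating limits are, for a bus voltage vector $v\in\mathbb C^{\mathcal V}$ and DC flows $p\in\mathbb R^{\mathcal D}$: * $\underline V_n\le |v_n|\le\overline V_n$ with $0<\underline V_n\le \overline V_n$; * $|\hat I_k|\le \hat I_k^{\max}$ and $|\check I_k|\le\check I_k^{\max}$, with $\hat I_k^{\max},\check I_k^{\max}\ge0$; * $(1+\underline\nu_k)|v_i|\le|v_j|\le(1+\overline\nu_k)|v_i|$ with $-1\le\underline\nu_k\le\overline\nu_k$; * $\mathrm{Re}(v_i^*v_j)\ge0$ and $\tan(\underline\delta_k)\,\mathrm{Re}(v_i^*v_j)\le \mathrm{Im}(v_i^*v_j)\le\tan(\overline\delta_k)\,\mathrm{Re}(v_i^*v_j)$, with $[\underline\delta_k,\overline\delta_k]\subset(-\pi/2,\pi/2)$; * $\underline p\le p\le\overline p$. Written as quadratic constraints (magnitudes squared) these are $M=2|\mathcal V|+7|\mathcal E|+2|\mathcal D|$ inequalities $\mathrm{tr}(C_m vv^H)+c_m^Tp\le b_m$ with Hermitian $C_m$, $c_m\in\mathbb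 R^{\mathcal D}$, $b_m\in\mathbb R$. At bus $n$, generation $g_n$ and load $d_n$ (active and reactive components) range over nonempty compact convex sets $\mathcal G_n,\mathcal D_n\subset\mathbb R^2$. The producer cost $C_n:\mathcal G_n\to\mathbb R$ is convex and the consumer benefit $B_n:\mathcal D_n\to\mathbb R$ is concave. The power balance is $$\big[\mathrm{tr}(P_nvv^H)+h_n^Tp,\ \mathrm{tr}(Q_nvv^H)\big]^T=g_n-d_n\quad\text{for all }n\in\mathcal V.$$ The optimal power flow (OPF) problem maximizes the welfare $\sum_nB_n(d_n)-\sum_nC_n(g_n)$ subject to the power balance and the limits. **Assumptions.** 1. AC branches are lossy and not capacitive: $\mathrm{Re}\,\bar y_k>0\ge\mathrm{Im}\,\bar y_k$. 2. The shunts do not dominate the series admittance: $\mathrm{Re}(\bar y_k^*(\bar y_k+\hat y_k))\ge0$ and $\mathrm{Re}(\bar y_k^*(\bar y_k+\check y_k))\ge0$ (for instance, $|\hat y_k|,|\check y_k|\le|\bar y_k|$). 3. The angle range takes the phase shift of the branch into account: $\underline\delta_k\le-\arg\rho_k\le\overline\delta_k$ (for a branch without phase shift, it contains $0$). 4. Hybrid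 architecture: the undirected multigraph with vertex set $\mathcal V$ and edges $\{\hat e(k),\check e(k)\}$, $k\in\mathcal E$, is a tree (in particular, it has no self-loops and no parallel or antiparallel branches). The DC branches are arbitrary. 5. Strict feasibility: there are $v,p$ and $g_n\in\mathcal G_n$, $d_n\in\mathcal D_n$ that satisfy the power balance, all $M$ inequalities strictly, and $g_n-d_n\in\mathrm{int}(\mathcal G_n-\mathcal D_n)$ for all $n$. **SOC relaxation.** Let $\mathcal I$ be the set of pairs $(i,j)$ such that $i,j\in\{\hat e(k),\check e(k)\}$ for some $k$. For $k\in\mathcal E$ let $S_k=[e_{\hat e(k)},e_{\check e(k)}]$ and $\Xi_k(X)=S_k^TXS_k$. The SOC relaxation is obtained from the OPF problem by replacing $vv^H$ by a Hermitian matrix $X$ that vanishes outside $\mathcal I$ and satisfies $\Xi_k(X)\succeq0$ for all $k\in\mathcal E$. It is *exact* if it has an optimizer $(X,p,g,d)$ for which some positive semidefinite matrix of rank $1$ agrees with $X$ on $\mathcal I$. Its Lagrangian dual is to minimize $$\mu^Tb+\sum_n\max_{d\in\mathcal D_n}\{B_n(d)-\Lambda_n^Td\}+\sum_n\max_{g\in\mathcal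 G_n}\{\Lambda_n^Tg-C_n(g)\}$$ (the maxima being read as suprema) over $\Lambda_n\in\mathbb R^2$, $\mu\in\mathbb R^M_{\ge0}$ and Hermitian $Z_k\succeq0$ in $\mathbb C^{2\times2}$, subject to $$\sum_n([\Lambda_n]_1P_n+[\Lambda_n]_2Q_n)+\sum_m\mu_mC_m=\sum_kS_kZ_kS_k^T,\qquad \sum_n[\Lambda_n]_1h_n+\sum_m\mu_mc_m=0 .$$ **Statement.** Let $(X^\star,p^\star,g^\star,d^\star)$ be any optimizer of the SOC relaxation and $(\Lambda^\star,\mu^\star,Z^\star)$ any optimizer of its dual. If $[\Lambda^\star_n]_1>0$ and $[\Lambda_n^\star]_2\ge0$ for all $n\in\mathcal V$, then $\mathrm{rank}\,\Xi_k(X^\star)=1$ for all $k\in\mathcal E$, and the SOC relaxation is exact. -/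

import Mathlib

open scoped Matrix ComplexConjugate ComplexOrder Pointwise

noncomputable section

/-- Data of a hybrid AC/DC transmission grid with bus set `V`, AC branches `E` and DC branches `D`,
together with its operating limits, its generators and loads, and the bids of the market
participants.

An AC branch `k` connects its source bus to its destination bus by an ideal transformer of complex
voltage ratio `ratioSrc k`, a Π-circuit with series admittance `ySeries k` and shunt admittances
`yShuntSrc k`, `yShuntDst k`, and an ideal transformer of complex voltage ratio `ratioDst k`. -/
structure HybridGrid (V E D : Type*) where
  /-- source bus of an AC branch -/
  acSrc : E → V
  /-- destination bus of an AC branch -/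
  acDst : E → V
  /-- source bus of a DC branch -/
  dcSrc : D → V
  /-- destination bus of a DC branch -/
  dcDst : D → V
  /-- shunt admittance of a bus -/
  yBus : V → ℂ
  /-- series admittance of an AC branch -/
  ySeries : E → ℂ
  /-- shunt admittance of an AC branch at its source -/
  yShuntSrc : E → ℂ
  /-- shunt admittance of an AC branch at its destination -/
  yShuntDst : E → ℂ
  /-- complex voltage ratio of the transformer at the source -/
  ratioSrc : E → ℂ
  /-- complex voltage ratio of the transformer at the destination -/
  ratioDst : E → ℂ
  /-- loss factor of a DC branch -/
  dcLoss : D → ℝ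
  /-- bounds on the bus voltage magnitude -/
  vMin : V → ℝ
  vMax : V → ℝ
  /-- bound on the current magnitude at the source of an AC branch -/
  iSrcMax : E → ℝ
  /-- bound on the current magnitude at the destination of an AC branch -/
  iDstMax : E → ℝ
  /-- bounds on the relative voltage magnitude drop `|v_dst| / |v_src| - 1` along an AC branch -/
  dropMin : E → ℝ
  dropMax : E → ℝ
  /-- bounds on the bus voltage angle difference `arg (conj v_src * v_dst)` of an AC branch -/
  angleMin : E → ℝ
  angleMax : E → ℝ
  /-- bounds on the power flow on a DC branch -/
  dcMin : D → ℝ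
  dcMax : D → ℝ
  /-- P-Q capability region of the generator at a bus; coordinate `0` is active power and
  coordinate `1` is reactive power -/
  genSet : V → Set (Fin 2 → ℝ)
  /-- admissible range of the load at a bus -/
  loadSet : V → Set (Fin 2 → ℝ)
  /-- producer cost function -/
  cost : V → (Fin 2 → ℝ) → ℝ
  /-- consumer benefit function -/
  benefit : V → (Fin 2 → ℝ) → ℝ

/-- The index set of the `2 |V| + 7 |E| + 2 |D|` inequality constraints. -/
abbrev IneqIdx (V E D : Type*) := (V × Fin 2) ⊕ (E × Fin 7) ⊕ (D × Fin 2)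

namespace HybridGrid

variable {V E D : Type*}

/-! ### Electrical model -/

/-- The total complex voltage ratio of an AC branch. -/
def ratio (N : HybridGrid V E D) (k : E) : ℂ := conj (N.ratioSrc k) * N.ratioDst k

/-- The row vector `a` with `a v` the current flowing into AC branch `k` at its source. -/
def currentSrc [DecidableEq V] (N : HybridGrid V E D) (k : E) : V → ℂ :=
  Pi.single (N.acSrc k) ((Complex.normSq (N.ratioSrc k) : ℂ) * (N.ySeries k + N.yShuntSrc k))
    + Pi.single (N.acDst k) (-(N.ratio k * N.ySeries k))

/-- The row vector `a` with `a v` the current flowing into AC branch `k` at its destination. -/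
def currentDst [DecidableEq V] (N : HybridGrid V E D) (k : E) : V → ℂ :=
  Pi.single (N.acDst k) ((Complex.normSq (N.ratioDst k) : ℂ) * (N.ySeries k + N.yShuntDst k))
    + Pi.single (N.acSrc k) (-(conj (N.ratio k) * N.ySeries k))

/-- The bus admittance matrix: `Y v` is the vector of currents injected at the buses. -/
def admittance [DecidableEq V] [Fintype E] (N : HybridGrid V E D) : Matrix V V ℂ :=
  Matrix.diagonal N.yBus
    + ∑ k : E, (Matrix.vecMulVec (Pi.single (N.acSrc k) 1) (N.currentSrc k)
      + Matrix.vecMulVec (Pi.single (N.acDst k) 1) (N.currentDst k))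

/-- The matrix with `vᴴ S v = v n * conj ((Y v) n)`, the complex power injected at bus `n`. -/
def powerMat [Fintype V] [DecidableEq V] [Fintype E]
    (N : HybridGrid V E D) (n : V) : Matrix V V ℂ :=
  N.admittanceᴴ * Matrix.single n n 1

/-- The Hermitian matrix of the active power injected into the AC subgrid at bus `n`. -/
def activeMat [Fintype V] [DecidableEq V] [Fintype E]
    (N : HybridGrid V E D) (n : V) : Matrix V V ℂ :=
  (1 / 2 : ℂ) • (N.powerMat n + (N.powerMat n)ᴴ)

/-- The Hermitian matrix of the reactive power injected into the AC subgrid at bus `n`. -/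
def reactiveMat [Fintype V] [DecidableEq V] [Fintype E]
    (N : HybridGrid V E D) (n : V) : Matrix V V ℂ :=
  (1 / (2 * Complex.I)) • (N.powerMat n - (N.powerMat n)ᴴ)

/-- The vector `h n` with `h n ⬝ᵥ p` the active power that flows from bus `n` into the DC branches,
a fraction `dcLoss l` of the flow `p l` being lost on the way to the destination. -/
def dcVec [DecidableEq V] (N : HybridGrid V E D) (n : V) (l : D) : ℝ :=
  (if N.dcSrc l = n then 1 else 0) - (if N.dcDst l = n then 1 - N.dcLoss l else 0)

/-! ### Inequality constraints -/

/-- The matrix of the Hermitian form `v ↦ Re (c * conj (v i) * v j)`. -/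
def crossMat [DecidableEq V] (i j : V) (c : ℂ) : Matrix V V ℂ :=
  Matrix.single i j (c / 2) + Matrix.single j i (conj c / 2)

/-- The matrix of the Hermitian form `v ↦ |a v|²`, for a row vector `a`. -/
def absSqMat (a : V → ℂ) : Matrix V V ℂ := Matrix.vecMulVec (star a) a

/-- The constraint matrices `C m`: for every bus, lower and upper bound on the voltage magnitude;
for every AC branch, current limit at the source and at the destination, lower and upper bound on
the voltage drop, the condition `Re (conj v_src * v_dst) ≥ 0`, and lower and upper bound on the
angle difference; zero for the DC branch limits. -/
def ineqMat [DecidableEq V] (N : HybridGrid V E D) : IneqIdx V E D → Matrix V V ℂ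
  | .inl (n, r) => ![-Matrix.single n n 1, Matrix.single n n 1] r
  | .inr (.inl (k, r)) =>
      let i := N.acSrc k
      let j := N.acDst k
      ![absSqMat (N.currentSrc k),
        absSqMat (N.currentDst k),
        (((1 + N.dropMin k) ^ 2 : ℝ) : ℂ) • Matrix.single i i 1 - Matrix.single j j 1,
        Matrix.single j j 1 - (((1 + N.dropMax k) ^ 2 : ℝ) : ℂ) • Matrix.single i i 1,
        crossMat i j (-1),
        crossMat i j ((Real.tan (N.angleMin k) : ℂ) + Complex.I),
        crossMat i j (-(Real.tan (N.angleMax k) : ℂ) - Complex.I)] r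
  | .inr (.inr _) => 0

/-- The vectors `c m`, which are nonzero only for the DC branch limits. -/
def ineqVec [DecidableEq D] (_N : HybridGrid V E D) : IneqIdx V E D → D → ℝ
  | .inl _ => 0
  | .inr (.inl _) => 0
  | .inr (.inr (l, r)) => ![-Pi.single l 1, Pi.single l 1] r

/-- The right-hand sides `b m`. -/
def ineqRhs (N : HybridGrid V E D) : IneqIdx V E D → ℝ
  | .inl (n, r) => ![-(N.vMin n) ^ 2, (N.vMax n) ^ 2] r
  | .inr (.inl (k, r)) => ![(N.iSrcMax k) ^ 2, (N.iDstMax k) ^ 2, 0, 0, 0, 0, 0] r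
  | .inr (.inr (l, r)) => ![-N.dcMin l, N.dcMax l] r

/-- The left-hand side `tr (C m X) + c m ⬝ᵥ p` of inequality constraint `m`. -/
def ineqLhs [Fintype V] [DecidableEq V] [Fintype D] [DecidableEq D]
    (N : HybridGrid V E D) (X : Matrix V V ℂ) (p : D → ℝ) (m : IneqIdx V E D) : ℝ :=
  (N.ineqMat m * X).trace.re + N.ineqVec m ⬝ᵥ p

/-- The net injection of active and reactive power into the grid at bus `n`, as a function of
`X` (which is `v vᴴ` for a bus voltage vector `v`) and of the DC branch flows. -/
def injection [Fintype V] [DecidableEq V] [Fintype E] [Fintype D]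
    (N : HybridGrid V E D) (X : Matrix V V ℂ) (p : D → ℝ) (n : V) : Fin 2 → ℝ :=
  ![(N.activeMat n * X).trace.re + N.dcVec n ⬝ᵥ p, (N.reactiveMat n * X).trace.re]

/-! ### Standing assumptions -/

/-- The assumptions on the model parameters. -/
structure IsPhysical (N : HybridGrid V E D) : Prop where
  /-- The transformer voltage ratios are nonzero. -/
  ratioSrc_ne : ∀ k, N.ratioSrc k ≠ 0
  ratioDst_ne : ∀ k, N.ratioDst k ≠ 0
  /-- AC branches are lossy. -/
  lossy : ∀ k, 0 < (N.ySeries k).re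
  /-- AC branches are not capacitive. -/
  inductive_ : ∀ k, (N.ySeries k).im ≤ 0
  /-- The shunts do not dominate the series admittance: the phase of `ySeries + yShunt` differs
  from that of `ySeries` by at most a right angle (in particular, `‖yShunt‖ ≤ ‖ySeries‖` is
  enough). -/
  shuntSrc : ∀ k, 0 ≤ (conj (N.ySeries k) * (N.ySeries k + N.yShuntSrc k)).re
  shuntDst : ∀ k, 0 ≤ (conj (N.ySeries k) * (N.ySeries k + N.yShuntDst k)).re
  vMin_pos : ∀ n, 0 < N.vMin n
  vMin_le : ∀ n, N.vMin n ≤ N.vMax n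
  iSrcMax_nonneg : ∀ k, 0 ≤ N.iSrcMax k
  iDstMax_nonneg : ∀ k, 0 ≤ N.iDstMax k
  dropMin_ge : ∀ k, -1 ≤ N.dropMin k
  dropMin_le : ∀ k, N.dropMin k ≤ N.dropMax k
  /-- The angle difference range is contained in `(-π/2, π/2)`, and it contains the angle
  difference at which the phases of the two voltages across the series element agree (this is
  `0` for a branch without phase shift). -/
  angleMin_gt : ∀ k, -(Real.pi / 2) < N.angleMin k
  angleMax_lt : ∀ k, N.angleMax k < Real.pi / 2
  angleMin_le : ∀ k, N.angleMin k ≤ -(N.ratio k).arg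
  le_angleMax : ∀ k, -(N.ratio k).arg ≤ N.angleMax k
  dcLoss_nonneg : ∀ l, 0 ≤ N.dcLoss l
  dcLoss_lt : ∀ l, N.dcLoss l < 1
  genSet_nonempty : ∀ n, (N.genSet n).Nonempty
  genSet_compact : ∀ n, IsCompact (N.genSet n)
  loadSet_nonempty : ∀ n, (N.loadSet n).Nonempty
  loadSet_compact : ∀ n, IsCompact (N.loadSet n)
  /-- Convexity of the generator regions and of the producer cost functions. -/
  cost_convex : ∀ n, ConvexOn ℝ (N.genSet n) (N.cost n)
  /-- Convexity of the load ranges and concavity of the consumer benefit functions. -/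
  benefit_concave : ∀ n, ConcaveOn ℝ (N.loadSet n) (N.benefit n)

/-- The hybrid architecture: the AC subgrid, as an undirected multigraph on all buses, is a tree
(no self-loops, no parallel or antiparallel branches, connected, acyclic). The DC branches are
arbitrary. -/
structure IsHybridArchitecture (N : HybridGrid V E D) : Prop where
  no_loop : ∀ k, N.acSrc k ≠ N.acDst k
  no_parallel : Function.Injective fun k => s(N.acSrc k, N.acDst k)
  isTree : (SimpleGraph.fromEdgeSet (Set.range fun k => s(N.acSrc k, N.acDst k))).IsTree

/-- Strict feasibility of the (nonconvex) optimal power flow problem. -/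
def StrictlyFeasible [Fintype V] [DecidableEq V] [Fintype E] [Fintype D] [DecidableEq D]
    (N : HybridGrid V E D) : Prop :=
  ∃ (v : V → ℂ) (p : D → ℝ) (g d : V → Fin 2 → ℝ),
    (∀ n, g n ∈ N.genSet n) ∧ (∀ n, d n ∈ N.loadSet n) ∧
    (∀ n, N.injection (Matrix.vecMulVec v (star v)) p n = g n - d n) ∧
    (∀ m, N.ineqLhs (Matrix.vecMulVec v (star v)) p m < N.ineqRhs m) ∧
    (∀ n, g n - d n ∈ interior (N.genSet n - N.loadSet n))

/-! ### The second-order cone relaxation -/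

/-- The positions of the entries that belong to the AC subgraph. -/
def pattern (N : HybridGrid V E D) : Set (V × V) :=
  {x | ∃ k, (x.1 = N.acSrc k ∨ x.1 = N.acDst k) ∧ (x.2 = N.acSrc k ∨ x.2 = N.acDst k)}

/-- Hermitian partial matrices on the AC subgraph. -/
def IsPartial (N : HybridGrid V E D) (X : Matrix V V ℂ) : Prop :=
  X.IsHermitian ∧ ∀ i j, (i, j) ∉ N.pattern → X i j = 0

/-- The matrix `S k` whose columns are the standard basis vectors of the source and of the
destination of AC branch `k`. -/
def selMat [DecidableEq V] (N : HybridGrid V E D) (k : E) : Matrix V (Fin 2) ℂ :=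
  Matrix.of fun n r => if n = ![N.acSrc k, N.acDst k] r then 1 else 0

/-- The `2 × 2` principal submatrix associated with AC branch `k`. -/
def branchMat [Fintype V] [DecidableEq V]
    (N : HybridGrid V E D) (k : E) (X : Matrix V V ℂ) : Matrix (Fin 2) (Fin 2) ℂ :=
  (N.selMat k)ᵀ * X * N.selMat k

/-- Economic welfare. -/
def welfare [Fintype V] (N : HybridGrid V E D) (g d : V → Fin 2 → ℝ) : ℝ :=
  ∑ n, N.benefit n (d n) - ∑ n, N.cost n (g n)

/-- Feasibility in the second-order cone relaxation. -/
structure SOCFeasible [Fintype V] [DecidableEq V] [Fintype E] [Fintype D] [DecidableEq D]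
    (N : HybridGrid V E D) (X : Matrix V V ℂ) (p : D → ℝ)
    (g d : V → Fin 2 → ℝ) : Prop where
  isPartial : N.IsPartial X
  gen_mem : ∀ n, g n ∈ N.genSet n
  load_mem : ∀ n, d n ∈ N.loadSet n
  balance : ∀ n, N.injection X p n = g n - d n
  ineq : ∀ m, N.ineqLhs X p m ≤ N.ineqRhs m
  psd : ∀ k, (N.branchMat k X).PosSemidef

/-- Optimality in the second-order cone relaxation. -/
def SOCOptimal [Fintype V] [DecidableEq V] [Fintype E] [Fintype D] [DecidableEq D]
    (N : HybridGrid V E D) (X : Matrix V V ℂ) (p : D → ℝ)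
    (g d : V → Fin 2 → ℝ) : Prop :=
  N.SOCFeasible X p g d ∧
    ∀ X' p' g' d', N.SOCFeasible X' p' g' d' → N.welfare g' d' ≤ N.welfare g d

/-- `X` permits a positive semidefinite rank-1 completion. -/
def HasRankOneCompletion [Fintype V] (N : HybridGrid V E D) (X : Matrix V V ℂ) : Prop :=
  ∃ W : Matrix V V ℂ, W.PosSemidef ∧ W.rank = 1 ∧ ∀ i j, (i, j) ∈ N.pattern → W i j = X i j

/-- Exactness of the second-order cone relaxation. -/
def SOCExact [Fintype V] [DecidableEq V] [Fintype E] [Fintype D] [DecidableEq D]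
    (N : HybridGrid V E D) : Prop :=
  ∃ X p g d, N.SOCOptimal X p g d ∧ N.HasRankOneCompletion X

/-! ### The Lagrangian dual of the second-order cone relaxation -/

/-- `Ψ(Λ, μ) = ∑ n, (Λ n 0 • P n + Λ n 1 • Q n) + ∑ m, μ m • C m`. -/
def dualMat [Fintype V] [DecidableEq V] [Fintype E] [Fintype D]
    (N : HybridGrid V E D) (L : V → Fin 2 → ℝ) (μ : IneqIdx V E D → ℝ) :
    Matrix V V ℂ :=
  ∑ n, ((L n 0 : ℂ) • N.activeMat n + (L n 1 : ℂ) • N.reactiveMat n)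
    + ∑ m, (μ m : ℂ) • N.ineqMat m

/-- `ψ(Λ, μ) = ∑ n, Λ n 0 • h n + ∑ m, μ m • c m`. -/
def dualVec [Fintype V] [DecidableEq V] [Fintype E] [Fintype D] [DecidableEq D]
    (N : HybridGrid V E D) (L : V → Fin 2 → ℝ) (μ : IneqIdx V E D → ℝ) : D → ℝ :=
  ∑ n, L n 0 • N.dcVec n + ∑ m, μ m • N.ineqVec m

/-- The consumer's surplus function of bus `n`. -/
def surplus (N : HybridGrid V E D) (n : V) (l : Fin 2 → ℝ) : ℝ :=
  sSup ((fun d => N.benefit n d - l ⬝ᵥ d) '' N.loadSet n)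

/-- The producer's profit function of bus `n`. -/
def profit (N : HybridGrid V E D) (n : V) (l : Fin 2 → ℝ) : ℝ :=
  sSup ((fun g => l ⬝ᵥ g - N.cost n g) '' N.genSet n)

/-- The dual objective. -/
def dualObj [Fintype V] [Fintype E] [Fintype D]
    (N : HybridGrid V E D) (L : V → Fin 2 → ℝ) (μ : IneqIdx V E D → ℝ) : ℝ :=
  μ ⬝ᵥ N.ineqRhs + ∑ n, N.surplus n (L n) + ∑ n, N.profit n (L n)

/-- Feasibility in the dual of the second-order cone relaxation. -/
structure DualFeasible [Fintype V] [DecidableEq V] [Fintype E] [Fintype D] [DecidableEq D]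
    (N : HybridGrid V E D) (L : V → Fin 2 → ℝ) (μ : IneqIdx V E D → ℝ)
    (Z : E → Matrix (Fin 2) (Fin 2) ℂ) : Prop where
  nonneg : ∀ m, 0 ≤ μ m
  dualMat_eq : N.dualMat L μ = ∑ k, N.selMat k * Z k * (N.selMat k)ᵀ
  dualVec_eq : N.dualVec L μ = 0
  psd : ∀ k, (Z k).PosSemidef

/-- Optimality in the dual of the second-order cone relaxation. -/
def DualOptimal [Fintype V] [DecidableEq V] [Fintype E] [Fintype D] [DecidableEq D]
    (N : HybridGrid V E D) (L : V → Fin 2 → ℝ) (μ : IneqIdx V E D → ℝ)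
    (Z : E → Matrix (Fin 2) (Fin 2) ℂ) : Prop :=
  N.DualFeasible L μ Z ∧ ∀ L' μ' Z', N.DualFeasible L' μ' Z' → N.dualObj L μ ≤ N.dualObj L' μ'

end HybridGrid

end

/-! The argument is complementary slackness. The relaxation is a convex problem with a Slater point,
so strong duality holds, and every pair of primal and dual optimizers satisfies tr(Z_k Ξ_k(X)) = 0
on each branch. If two positive semidefinite 2×2 matrices have trace product zero and the first is
not diagonal, then the second is singular (`det_eq_zero_of_trace_mul_re_eq_zero`). The lower voltage
limits keep the diagonal of X positive, so each Ξ_k(X) has rank exactly 1.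

It remains to see that Z_k is not diagonal. A branch is determined by its endpoints, so the dual
constraint identifies the off-diagonal entry of Z_k with the (source, destination) entry of Ψ(Λ, μ).
This entry has the form -ρA + B/2, where B collects the multipliers of the angle constraints.
Losses, the sign of Im y, the shunt condition and the signs of the prices give Re A > 0; the angle
assumption gives Re(ρ* B) ≤ 0. After multiplication by ρ* the real part is negative
(`HybridGrid.dualMat_src_dst_ne_zero`).

Strong duality comes from a supergradient at 0 of the optimal value as a function of perturbations
of the constraints (`Convex.exists_supergradient`). Connectedness and acyclicity of the AC subgrid
enter only for exactness: singular branch blocks prescribe voltage ratios along the edges, and on a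
tree these integrate to a voltage vector (`SimpleGraph.IsTree.exists_potential`,
`HybridGrid.IsHybridArchitecture.hasRankOneCompletion`). -/

/-! ### Separation and supergradients in finite dimension. -/

section Convexity

/-- A point outside a nonempty convex set of a finite-dimensional space is weakly separated from
it by a nonzero linear functional. -/
theorem Convex.exists_ne_zero_forall_nonpos {F : Type*} [NormedAddCommGroup F] [NormedSpace ℝ F]
    [FiniteDimensional ℝ F] {B : Set F} (hB : Convex ℝ B) (hne : B.Nonempty) (h0 : (0 : F) ∉ B) :
    ∃ f : F →ₗ[ℝ] ℝ, f ≠ 0 ∧ ∀ y ∈ B, f y ≤ 0 := by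
  by_cases hint : (interior B).Nonempty
  · obtain ⟨f, hf, hfB⟩ := geometric_hahn_banach_of_nonempty_interior_point hB
      (fun h => h0 (interior_subset h)) hint
    refine ⟨f, fun h => hf ?_, fun y hy => by simpa using hfB y hy⟩
    ext y
    exact LinearMap.congr_fun h y
  -- With empty interior, `B` lies in a proper affine subspace. A functional that kills its
  -- direction is constant on `B`, and its sign is free.
  · rw [hB.interior_nonempty_iff_affineSpan_eq_top] at hint
    obtain ⟨b, hb⟩ := hne
    have hdir : (affineSpan ℝ B).direction < ⊤ := by
      refine lt_top_iff_ne_top.2 fun h => hint ?_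
      exact (AffineSubspace.direction_eq_top_iff_of_nonempty
        ⟨b, subset_affineSpan ℝ B hb⟩).1 h
    obtain ⟨f, hf, hker⟩ := Submodule.exists_le_ker_of_lt_top _ hdir
    have hconst : ∀ y ∈ B, f y = f b := fun y hy => by
      have := hker (AffineSubspace.vsub_mem_direction (subset_affineSpan ℝ B hy)
        (subset_affineSpan ℝ B hb))
      rw [LinearMap.mem_ker, vsub_eq_sub, map_sub] at this
      linarith
    rcases le_total (f b) 0 with h | h
    · exact ⟨f, hf, fun y hy => (hconst y hy).trans_le h⟩
    · exact ⟨-f, neg_ne_zero.2 hf, fun y hy => by simpa [hconst y hy] using h⟩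

/-- A concave function on a finite-dimensional space, given by a convex subset `A` of its
hypograph, has a supergradient at an interior point of its domain. -/
theorem Convex.exists_supergradient {F : Type*} [NormedAddCommGroup F] [NormedSpace ℝ F]
    [FiniteDimensional ℝ F] {A : Set (ℝ × F)} (hA : Convex ℝ A)
    (h0 : ∀ t, (t, (0 : F)) ∈ A → t ≤ 0) (hdom : ∀ᶠ y in nhds (0 : F), ∃ t, (t, y) ∈ A) :
    ∃ l : F →ₗ[ℝ] ℝ, ∀ t y, (t, y) ∈ A → t ≤ l y := by
  -- Points strictly below `A`: the strict inequality is what excludes the origin.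
  set B : Set (ℝ × F) := {x | ∃ s, x.1 < s ∧ (s, x.2) ∈ A} with hBdef
  have hB : Convex ℝ B := by
    rintro ⟨t, y⟩ ⟨s, hs, hsA⟩ ⟨t', y'⟩ ⟨s', hs', hsA'⟩ a b ha hb hab
    refine ⟨a * s + b * s', ?_, by simpa using hA hsA hsA' ha hb hab⟩
    simp only [Prod.smul_mk, Prod.mk_add_mk, smul_eq_mul]
    simp only at hs hs'
    rcases ha.eq_or_lt with rfl | ha
    · obtain rfl : b = 1 := by linarith
      simpa using hs'
    · exact add_lt_add_of_lt_of_le (mul_lt_mul_of_pos_left hs ha)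
        (mul_le_mul_of_nonneg_left hs'.le hb)
  obtain ⟨t₀, ht₀⟩ := hdom.self_of_nhds
  obtain ⟨f, hf, hfB⟩ := hB.exists_ne_zero_forall_nonpos ⟨(t₀ - 1, 0), t₀, by simp, ht₀⟩ (by
    rintro ⟨s, hs, hsA⟩
    exact absurd (h0 s hsA) (not_le.2 hs))
  have hsplit : ∀ t y, f (t, y) = t * f (1, 0) + f (0, y) := fun t y => by
    have : ((t, y) : ℝ × F) = t • (1, 0) + (0, y) := by simp
    rw [this, map_add, map_smul, smul_eq_mul]
  have hτ : 0 ≤ f (1, 0) := by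
    by_contra! hneg
    have h1 := hfB (t₀ - 1, 0) ⟨t₀, by simp, ht₀⟩
    -- This height equals `-(t₀ - 5 / 2) ^ 2 - 3 / 4`, negative for every `t₀`, so a negative `f (1,
    -- 0)` would make `f` positive there.
    have h2 := hfB (t₀ - 1 - (t₀ - 2) ^ 2 - 2, 0) ⟨t₀, by nlinarith [sq_nonneg (t₀ - 2)], ht₀⟩
    have h3 : f ((0 : ℝ), (0 : F)) = 0 := by
      rw [show ((0 : ℝ), (0 : F)) = 0 from rfl, map_zero]
    rw [hsplit, h3] at h1 h2
    nlinarith [sq_nonneg (t₀ - 2), sq_nonneg (t₀ - 5 / 2)]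
  -- The hyperplane is not vertical: otherwise `f (0, ·)` is nonpositive near 0, hence everywhere by
  -- scaling, hence zero by `y ↦ -y`.
  have hpos : 0 < f (1, 0) := by
    refine hτ.lt_of_ne fun hzero => hf ?_
    have hloc : ∀ᶠ y in nhds (0 : F), f (0, y) ≤ 0 := by
      filter_upwards [hdom] with y ⟨t, ht⟩
      have := hfB (t - 1, y) ⟨t, by simp, ht⟩
      rwa [hsplit, ← hzero, mul_zero, zero_add] at this
    have hnonpos : ∀ y, f (0, y) ≤ 0 := fun y => by
      have hc : Filter.Tendsto (fun r : ℝ => r • y) (nhdsWithin 0 (Set.Ioi 0)) (nhds 0) := by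
        have : Continuous fun r : ℝ => r • y := by fun_prop
        simpa using (this.tendsto 0).mono_left nhdsWithin_le_nhds
      obtain ⟨r, hr, hr0⟩ := ((hc.eventually hloc).and self_mem_nhdsWithin).exists
      rw [show ((0 : ℝ), r • y) = r • (0, y) by simp, map_smul, smul_eq_mul] at hr
      exact nonpos_of_mul_nonpos_right hr hr0
    ext y
    · simpa using hzero.symm
    · have h1 := hnonpos y
      have h2 := hnonpos (-y)
      rw [show ((0 : ℝ), -y) = -(0, y) by simp, map_neg] at h2
      simpa using le_antisymm h1 (by linarith)
  refine ⟨-(f (1, 0))⁻¹ • f ∘ₗ LinearMap.inr ℝ ℝ F, fun t y hty => ?_⟩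
  refine le_of_forall_lt fun s hs => ?_
  -- The midpoint lies strictly below `t`, so it is in `B`, and still strictly above `s`.
  have h1 := hfB ((s + t) / 2, y) ⟨t, by simp only; linarith, hty⟩
  rw [hsplit] at h1
  simp only [LinearMap.smul_apply, LinearMap.comp_apply, LinearMap.inr_apply, smul_eq_mul]
  have h2 : (s + t) / 2 ≤ -(f (1, 0))⁻¹ * f (0, y) := by
    rw [neg_mul, ← mul_neg, le_inv_mul_iff₀ hpos]
    linarith
  linarith

/-- If every choice of values of finitely many functions has a sum of at most `c`, then so has the
choice of the suprema. -/
theorem Finset.sum_csSup_le {ι : Type*} (s : Finset ι) (S : ι → Set ℝ)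
    (hne : ∀ i ∈ s, (S i).Nonempty) (c : ℝ)
    (h : ∀ x : ι → ℝ, (∀ i ∈ s, x i ∈ S i) → ∑ i ∈ s, x i ≤ c) : ∑ i ∈ s, sSup (S i) ≤ c := by
  refine le_of_forall_pos_le_add fun ε hε => ?_
  -- The `+ 1` covers the empty index set.
  have hcard : (0 : ℝ) < s.card + 1 := by positivity
  have : ∀ i, ∃ x, i ∈ s → x ∈ S i ∧ sSup (S i) - ε / (s.card + 1) < x := fun i => by
    by_cases hi : i ∈ s
    · obtain ⟨x, hx, hlt⟩ := exists_lt_of_lt_csSup (hne i hi)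
        (sub_lt_self (sSup (S i)) (div_pos hε hcard))
      exact ⟨x, fun _ => ⟨hx, hlt⟩⟩
    · exact ⟨0, fun h => absurd h hi⟩
  choose x hx using this
  calc ∑ i ∈ s, sSup (S i) ≤ ∑ i ∈ s, (x i + ε / (s.card + 1)) :=
        Finset.sum_le_sum fun i hi => by linarith [(hx i hi).2]
    _ = ∑ i ∈ s, x i + s.card * (ε / (s.card + 1)) := by
        rw [Finset.sum_add_distrib, Finset.sum_const, nsmul_eq_mul]
    _ ≤ c + ε := by
        refine add_le_add (h x fun i hi => (hx i hi).1) ?_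
        rw [mul_div_assoc', div_le_iff₀ hcard]
        nlinarith

end Convexity

/-! ### Potentials on trees. -/

section Tree

/-- On a tree, the edge labels of a group-valued labelling of the darts come from a labelling of the
vertices. -/
theorem SimpleGraph.IsTree.exists_potential {V A : Type*} [CommGroup A] {G : SimpleGraph V}
    (hG : G.IsTree) (c : V → V → A) (hc : ∀ u v, G.Adj u v → c v u = (c u v)⁻¹) :
    ∃ φ : V → A, ∀ u v, G.Adj u v → φ v = φ u * c u v := by
  classical
  obtain ⟨r⟩ := hG.connected.nonempty
  choose P hP hPu using fun v => hG.existsUnique_path r v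
  -- The potential at `v` is the product of the labels along the unique path from `r` to `v`.
  let w : ∀ {a b}, G.Walk a b → A := fun q => (q.darts.map fun d => c d.fst d.snd).prod
  have key : ∀ u v (h : G.Adj u v), v ∉ (P u).support → w (P v) = w (P u) * c u v := by
    intro u v h hv
    have : P v = (P u).concat h :=
      (hPu v _ ((hP u).concat hv h)).symm
    simp [w, this, SimpleGraph.Walk.darts_concat]
  refine ⟨fun v => w (P v), fun u v h => ?_⟩
  by_cases hv : v ∈ (P u).support
  -- If each vertex lay on the path to the other, each path would be a truncation of the other, and
  -- the lengths would contradict each other.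
  · have hu : u ∉ (P v).support := by
      intro hu
      have h1 : (P u).takeUntil v hv = P v := hPu v _ ((hP u).takeUntil hv)
      have h2 : (P v).takeUntil u hu = P u := hPu u _ ((hP v).takeUntil hu)
      have l1 := SimpleGraph.Walk.length_takeUntil_lt_length hv h.ne'
      have l2 := SimpleGraph.Walk.length_takeUntil_le_length (P v) hu
      rw [h1] at l1
      rw [h2] at l2
      omega
    have := key v u h.symm hu
    simp only [this, hc u v h, inv_mul_cancel_right]
  · exact key u v h hv

end Tree

noncomputable section

/-! ### The cone of positive semidefinite 2×2 matrices in four real coordinates. -/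

section HermitianTwo

/-- The Hermitian `2 × 2` matrix with diagonal `q 0`, `q 1` and off-diagonal entry
`q 2 + q 3 * I`. -/
def herm2 (q : Fin 4 → ℝ) : Matrix (Fin 2) (Fin 2) ℂ :=
  !![(q 0 : ℂ), ⟨q 2, q 3⟩; ⟨q 2, -q 3⟩, (q 1 : ℂ)]

/-- The real coordinates of a Hermitian `2 × 2` matrix. -/
def herm2Coord (H : Matrix (Fin 2) (Fin 2) ℂ) : Fin 4 → ℝ :=
  ![(H 0 0).re, (H 1 1).re, (H 0 1).re, (H 0 1).im]

theorem herm2_isHermitian (q : Fin 4 → ℝ) : (herm2 q).IsHermitian := by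
  ext i j
  fin_cases i <;> fin_cases j <;> simp [herm2, Complex.ext_iff]

theorem Matrix.IsHermitian.herm2_herm2Coord {H : Matrix (Fin 2) (Fin 2) ℂ} (hH : H.IsHermitian) :
    herm2 (herm2Coord H) = H := by
  have h00 := hH.apply 0 0
  have h11 := hH.apply 1 1
  have h10 := hH.apply 1 0
  ext i j
  fin_cases i <;> fin_cases j <;>
    simp [herm2, herm2Coord, Complex.ext_iff, ← h10] <;>
    simp only [Complex.ext_iff, Complex.star_def, Complex.conj_re, Complex.conj_im] at h00 h11 <;>
    linarith

theorem herm2_add (q r : Fin 4 → ℝ) : herm2 (q + r) = herm2 q + herm2 r := by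
  ext i j
  fin_cases i <;> fin_cases j <;> simp [herm2, Complex.ext_iff, add_comm]

theorem herm2_smul (a : ℝ) (q : Fin 4 → ℝ) : herm2 (a • q) = a • herm2 q := by
  ext i j
  fin_cases i <;> fin_cases j <;> simp [herm2, Complex.ext_iff]

theorem star_dotProduct_herm2_mulVec (q : Fin 4 → ℝ) (x : Fin 2 → ℂ) :
    star x ⬝ᵥ (herm2 q *ᵥ x) =
      ((q 0 * Complex.normSq (x 0) + q 1 * Complex.normSq (x 1) +
        2 * (q 2 * (conj (x 0) * x 1).re - q 3 * (conj (x 0) * x 1).im) : ℝ) : ℂ) := by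
  simp [herm2, dotProduct, Matrix.mulVec, Fin.sum_univ_two, Complex.ext_iff, Complex.normSq_apply]
  constructor <;> ring

theorem posSemidef_herm2_iff (q : Fin 4 → ℝ) :
    (herm2 q).PosSemidef ↔ 0 ≤ q 0 ∧ 0 ≤ q 1 ∧ q 2 ^ 2 + q 3 ^ 2 ≤ q 0 * q 1 := by
  constructor
  · intro h
    have h0 : (0 : ℂ) ≤ herm2 q 0 0 := h.diag_nonneg
    have h1 : (0 : ℂ) ≤ herm2 q 1 1 := h.diag_nonneg
    have hd := h.det_nonneg
    simp only [Matrix.det_fin_two, herm2, Matrix.of_apply, Matrix.cons_val', Matrix.cons_val_zero,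
      Matrix.cons_val_one, Matrix.cons_val_fin_one, Complex.le_def, Complex.zero_re, Complex.sub_re,
      Complex.mul_re, Complex.ofReal_re, Complex.ofReal_im] at h0 h1 hd
    exact ⟨h0.1, h1.1, by nlinarith [hd.1]⟩
  · rintro ⟨h0, h1, h2⟩
    refine .of_dotProduct_mulVec_nonneg (herm2_isHermitian q) fun x => ?_
    rw [star_dotProduct_herm2_mulVec, Complex.zero_le_real, Complex.normSq_apply,
      Complex.normSq_apply, Complex.mul_re, Complex.mul_im, Complex.conj_re, Complex.conj_im]
    generalize (x 0).re = a, (x 0).im = b, (x 1).re = c, (x 1).im = d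
    rcases h0.eq_or_lt with h0 | h0
    · rw [← h0, zero_mul] at h2
      have h3 : q 2 = 0 := by nlinarith [sq_nonneg (q 2), sq_nonneg (q 3)]
      have h4 : q 3 = 0 := by nlinarith [sq_nonneg (q 2), sq_nonneg (q 3)]
      rw [← h0, h3, h4]
      have := mul_nonneg h1 (add_nonneg (mul_self_nonneg c) (mul_self_nonneg d))
      linarith
    -- Completing the square: `q 0` times the form is |q₀x₀ + (q₂ + iq₃)x₁|² + (q₀q₁ - q₂² -
    -- q₃²)|x₁|².
    · refine nonneg_of_mul_nonneg_left (b := q 0) ?_ h0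
      have h5 := mul_nonneg (sub_nonneg.2 h2) (add_nonneg (mul_self_nonneg c) (mul_self_nonneg d))
      have h6 := sq_nonneg (q 0 * a + q 2 * c - q 3 * d)
      have h7 := sq_nonneg (q 0 * b + q 2 * d + q 3 * c)
      nlinarith

theorem trace_herm2_mul_herm2 (c q : Fin 4 → ℝ) :
    (herm2 c * herm2 q).trace.re = c 0 * q 0 + c 1 * q 1 + 2 * (c 2 * q 2) + 2 * (c 3 * q 3) := by
  simp [herm2, Matrix.trace, Fin.sum_univ_two]
  ring

/-- The matrix that represents the functional `q ↦ c ⬝ᵥ q` in the trace inner product. -/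
def herm2Dual (c : Fin 4 → ℝ) : Matrix (Fin 2) (Fin 2) ℂ := herm2 ![c 0, c 1, c 2 / 2, c 3 / 2]

theorem trace_herm2Dual_mul_herm2 (c q : Fin 4 → ℝ) :
    (herm2Dual c * herm2 q).trace.re = c ⬝ᵥ q := by
  simp [herm2Dual, trace_herm2_mul_herm2, dotProduct, Fin.sum_univ_four]
  ring

/-- The cone of positive semidefinite `2 × 2` matrices is self-dual. -/
theorem posSemidef_herm2Dual (c : Fin 4 → ℝ) (h : ∀ q, (herm2 q).PosSemidef → 0 ≤ c ⬝ᵥ q) :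
    (herm2Dual c).PosSemidef := by
  refine .of_dotProduct_mulVec_nonneg (herm2_isHermitian _) fun x => ?_
  rw [herm2Dual, star_dotProduct_herm2_mulVec, Complex.zero_le_real]
  -- These are the coordinates of the rank-one matrix x xᴴ.
  have := h ![Complex.normSq (x 0), Complex.normSq (x 1), (conj (x 0) * x 1).re,
    -(conj (x 0) * x 1).im] ((posSemidef_herm2_iff _).2
      ⟨Complex.normSq_nonneg _, Complex.normSq_nonneg _, by
        simp [Complex.normSq_apply]; nlinarith⟩)
  simp only [dotProduct, Fin.sum_univ_four, Matrix.cons_val] at this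
  simp only [Matrix.cons_val]
  linarith

/-- By Cauchy–Schwarz and the two determinant conditions, the off-diagonal contribution is at most
twice the geometric mean of the two diagonal products in absolute value; the arithmetic-geometric
inequality does the rest. -/
theorem trace_mul_re_nonneg_of_posSemidef {Z H : Matrix (Fin 2) (Fin 2) ℂ} (hZ : Z.PosSemidef)
    (hH : H.PosSemidef) : 0 ≤ (Z * H).trace.re := by
  have eZ := hZ.isHermitian.herm2_herm2Coord
  have eH := hH.isHermitian.herm2_herm2Coord
  rw [← eZ] at hZ
  rw [← eH] at hH
  rw [← eZ, ← eH, trace_herm2_mul_herm2]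
  rw [posSemidef_herm2_iff] at hZ hH
  generalize herm2Coord Z = c, herm2Coord H = q at *
  obtain ⟨hc0, hc1, hc⟩ := hZ
  obtain ⟨hq0, hq1, hq⟩ := hH
  have h1 : (c 2 * q 2 + c 3 * q 3) ^ 2 ≤ (c 0 * q 0) * (c 1 * q 1) := by
    have := mul_le_mul hc hq (by positivity) (by positivity)
    nlinarith [sq_nonneg (c 2 * q 3 - c 3 * q 2)]
  have h2 : (2 * (c 2 * q 2 + c 3 * q 3)) ^ 2 ≤ (c 0 * q 0 + c 1 * q 1) ^ 2 := by
    nlinarith [sq_nonneg (c 0 * q 0 - c 1 * q 1)]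
  have := abs_le_of_sq_le_sq' h2 (by positivity)
  linarith [this.1]

/-- If the trace product of two positive semidefinite `2 × 2` matrices vanishes and the first one is
not diagonal, then the second one is singular. -/
theorem det_eq_zero_of_trace_mul_re_eq_zero {Z H : Matrix (Fin 2) (Fin 2) ℂ} (hZ : Z.PosSemidef)
    (hH : H.PosSemidef) (htr : (Z * H).trace.re = 0) (hZ01 : Z 0 1 ≠ 0) : H.det = 0 := by
  have hZ01' : 0 < herm2Coord Z 2 ^ 2 + herm2Coord Z 3 ^ 2 := by
    have := Complex.normSq_pos.2 hZ01
    rw [Complex.normSq_apply] at this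
    simp only [herm2Coord, Matrix.cons_val]
    nlinarith
  have eZ := hZ.isHermitian.herm2_herm2Coord
  have eH := hH.isHermitian.herm2_herm2Coord
  rw [← eZ] at hZ
  rw [← eH] at hH ⊢
  rw [← eZ, ← eH, trace_herm2_mul_herm2] at htr
  rw [posSemidef_herm2_iff] at hZ hH
  generalize herm2Coord Z = c, herm2Coord H = q at *
  obtain ⟨hc0, hc1, hc⟩ := hZ
  obtain ⟨hq0, hq1, hq⟩ := hH
  have h1 : (c 2 * q 2 + c 3 * q 3) ^ 2 ≤ (c 0 * c 1) * (q 2 ^ 2 + q 3 ^ 2) := by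
    have := mul_le_mul_of_nonneg_right hc (by positivity : 0 ≤ q 2 ^ 2 + q 3 ^ 2)
    nlinarith [sq_nonneg (c 2 * q 3 - c 3 * q 2)]
  have h2 : (c 0 * q 0 + c 1 * q 1) ^ 2 = 4 * (c 2 * q 2 + c 3 * q 3) ^ 2 := by
    rw [show c 0 * q 0 + c 1 * q 1 = -(2 * (c 2 * q 2 + c 3 * q 3)) by linarith]
    ring
  -- The zero trace gives (c₀q₀ + c₁q₁)² ≤ 4c₀c₁(q₂² + q₃²), while the left side is at least
  -- 4c₀q₀c₁q₁. The factor c₀c₁ is positive because it dominates |Z₀₁|².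
  have h3 : (c 0 * c 1) * (q 0 * q 1 - (q 2 ^ 2 + q 3 ^ 2)) ≤ 0 := by
    nlinarith [sq_nonneg (c 0 * q 0 - c 1 * q 1)]
  have h4 : q 0 * q 1 - (q 2 ^ 2 + q 3 ^ 2) = 0 :=
    le_antisymm (nonpos_of_mul_nonpos_right h3 (hZ01'.trans_le hc)) (sub_nonneg.2 hq)
  simp [Matrix.det_fin_two, herm2, Complex.ext_iff]
  exact ⟨by linarith, by ring⟩

theorem Matrix.rank_ne_zero {m n : Type*} [Fintype n] {A : Matrix m n ℂ} [Finite m] (hA : A ≠ 0) :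
    A.rank ≠ 0 := by
  classical
  intro h
  rw [Matrix.rank, Submodule.finrank_eq_zero, LinearMap.range_eq_bot] at h
  exact hA (Matrix.toLin'.injective (by rwa [map_zero]))

theorem Matrix.rank_eq_one_of_det_eq_zero {H : Matrix (Fin 2) (Fin 2) ℂ} (hdet : H.det = 0)
    (hH : H ≠ 0) : H.rank = 1 := by
  have h0 : H.rank ≠ 0 := Matrix.rank_ne_zero hH
  have h2 : H.rank ≠ 2 := fun h => by
    have hu : IsUnit H := by
      rw [← Matrix.linearIndependent_rows_iff_isUnit, linearIndependent_iff_card_eq_finrank_span,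
        Fintype.card_fin, Set.finrank, ← Matrix.rank_eq_finrank_span_row, h]
    exact ((Matrix.isUnit_iff_isUnit_det _).1 hu).ne_zero hdet
  have hle : H.rank ≤ 2 := by simpa using H.rank_le_width
  omega

/-- The Hermitian matrices near a positive definite one are positive semidefinite. -/
theorem eventually_posSemidef_herm2 {q : Fin 4 → ℝ} (h0 : 0 < q 0) (h1 : 0 < q 1)
    (h : q 2 ^ 2 + q 3 ^ 2 < q 0 * q 1) :
    ∀ᶠ w in nhds q, (herm2 w).PosSemidef := by
  have c0 : ∀ᶠ w : Fin 4 → ℝ in nhds q, 0 < w 0 :=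
    (continuous_apply 0).continuousAt.eventually_const_lt h0
  have c1 : ∀ᶠ w : Fin 4 → ℝ in nhds q, 0 < w 1 :=
    (continuous_apply 1).continuousAt.eventually_const_lt h1
  have c2 : ∀ᶠ w : Fin 4 → ℝ in nhds q, w 2 ^ 2 + w 3 ^ 2 < w 0 * w 1 :=
    ContinuousAt.eventually_lt (f := fun w : Fin 4 → ℝ => w 2 ^ 2 + w 3 ^ 2)
      (g := fun w => w 0 * w 1) (by fun_prop) (by fun_prop) h
  filter_upwards [c0, c1, c2] with w h0 h1 h2
  exact (posSemidef_herm2_iff w).2 ⟨h0.le, h1.le, h2.le⟩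

end HermitianTwo

namespace HybridGrid

/-! ### Sparsity of the grid matrices and the off-diagonal entries of the dual matrix. -/

section Matrices

variable {V E D : Type*}

/-- Bus `a` is an endpoint of AC branch `k`. -/
def OnBranch (N : HybridGrid V E D) (k : E) (a : V) : Prop := a = N.acSrc k ∨ a = N.acDst k

theorem pattern_symm (N : HybridGrid V E D) {a b : V} (h : (a, b) ∈ N.pattern) :
    (b, a) ∈ N.pattern := by
  obtain ⟨k, ha, hb⟩ := h
  exact ⟨k, hb, ha⟩

/-- Used to single out one branch: in a sum of matrices supported on the branches, the (source,
destination) entry of `k` receives a contribution from `k` alone. -/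
theorem IsHybridArchitecture.eq_of_onBranch {N : HybridGrid V E D} (h : N.IsHybridArchitecture)
    {k k' : E} (hs : N.OnBranch k' (N.acSrc k)) (hd : N.OnBranch k' (N.acDst k)) : k' = k := by
  refine h.no_parallel ?_
  have := h.no_loop k
  rcases hs with hs | hs <;> rcases hd with hd | hd
  · exact absurd (hs.trans hd.symm) this
  · simp only [hs, hd]
  · simp only [hs, hd, Sym2.eq_swap]
  · exact absurd (hs.trans hd.symm) this

theorem absSqMat_apply_eq_zero {a : V → ℂ} {i j : V} (h : a i = 0 ∨ a j = 0) :
    absSqMat a i j = 0 := by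
  rcases h with h | h <;> simp [absSqMat, Matrix.vecMulVec_apply, h]

theorem absSqMat_isHermitian (a : V → ℂ) : (absSqMat a).IsHermitian := by
  ext i j
  simp [absSqMat, Matrix.vecMulVec_apply, mul_comm]

theorem isHermitian_ofReal_smul {A : Matrix V V ℂ} (hA : A.IsHermitian) (c : ℝ) :
    ((c : ℂ) • A).IsHermitian := by
  rw [Matrix.IsHermitian, Matrix.conjTranspose_smul, hA.eq, Complex.star_def, Complex.conj_ofReal]

theorem isHermitian_sum {ι : Type*} (s : Finset ι) {f : ι → Matrix V V ℂ}
    (hf : ∀ i, (f i).IsHermitian) : (∑ i ∈ s, f i).IsHermitian := by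
  rw [Matrix.IsHermitian, Matrix.conjTranspose_sum]
  exact Finset.sum_congr rfl fun i _ => hf i

variable [DecidableEq V]

theorem onBranch_of_currentSrc_ne_zero (N : HybridGrid V E D) {k : E} {a : V}
    (h : N.currentSrc k a ≠ 0) : N.OnBranch k a := by
  by_contra hn
  simp only [OnBranch, not_or] at hn
  simp [currentSrc, hn] at h

theorem onBranch_of_currentDst_ne_zero (N : HybridGrid V E D) {k : E} {a : V}
    (h : N.currentDst k a ≠ 0) : N.OnBranch k a := by
  by_contra hn
  simp only [OnBranch, not_or] at hn
  simp [currentDst, hn] at h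

theorem single_apply_eq_zero_of_not_onBranch (N : HybridGrid V E D) {k : E} {a b i j : V} (c : ℂ)
    (hi : N.OnBranch k i) (hj : N.OnBranch k j) (h : ¬(N.OnBranch k a ∧ N.OnBranch k b)) :
    Matrix.single i j c a b = 0 := by
  refine Matrix.single_apply_of_ne _ _ _ _ _ ?_
  rintro ⟨rfl, rfl⟩
  exact h ⟨hi, hj⟩

theorem ineqMat_branch_eq_zero (N : HybridGrid V E D) {k : E} {a b : V} (r : Fin 7)
    (h : ¬(N.OnBranch k a ∧ N.OnBranch k b)) : N.ineqMat (.inr (.inl (k, r))) a b = 0 := by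
  have hs : N.OnBranch k (N.acSrc k) := .inl rfl
  have hd : N.OnBranch k (N.acDst k) := .inr rfl
  have hss := fun c => N.single_apply_eq_zero_of_not_onBranch c hs hs h
  have hsd := fun c => N.single_apply_eq_zero_of_not_onBranch c hs hd h
  have hds := fun c => N.single_apply_eq_zero_of_not_onBranch c hd hs h
  have hdd := fun c => N.single_apply_eq_zero_of_not_onBranch c hd hd h
  have h1 : absSqMat (N.currentSrc k) a b = 0 := absSqMat_apply_eq_zero <| by
    by_contra! hn
    exact h ⟨N.onBranch_of_currentSrc_ne_zero hn.1, N.onBranch_of_currentSrc_ne_zero hn.2⟩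
  have h2 : absSqMat (N.currentDst k) a b = 0 := absSqMat_apply_eq_zero <| by
    by_contra! hn
    exact h ⟨N.onBranch_of_currentDst_ne_zero hn.1, N.onBranch_of_currentDst_ne_zero hn.2⟩
  fin_cases r <;> simp [ineqMat, crossMat, hss, hsd, hds, hdd, h1, h2]

theorem ineqMat_apply_eq_zero (N : HybridGrid V E D) (hdiag : ∀ n, (n, n) ∈ N.pattern)
    (m : IneqIdx V E D) {a b : V} (h : (a, b) ∉ N.pattern) : N.ineqMat m a b = 0 := by
  rcases m with ⟨n, r⟩ | ⟨k, r⟩ | ⟨l, r⟩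
  · have : Matrix.single n n (1 : ℂ) a b = 0 := by
      refine Matrix.single_apply_of_ne _ _ _ _ _ ?_
      rintro ⟨rfl, rfl⟩
      exact h (hdiag _)
    fin_cases r <;> simp [ineqMat, this]
  · exact N.ineqMat_branch_eq_zero r fun hk => h ⟨k, hk⟩
  · rfl

theorem single_isHermitian (n : V) : (Matrix.single n n (1 : ℂ)).IsHermitian := by
  simp [Matrix.IsHermitian, Matrix.conjTranspose_single]

theorem crossMat_isHermitian (i j : V) (c : ℂ) : (crossMat i j c).IsHermitian := by
  simp [crossMat, Matrix.IsHermitian, Matrix.conjTranspose_add, Matrix.conjTranspose_single,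
    add_comm]

theorem ineqMat_isHermitian (N : HybridGrid V E D) (m : IneqIdx V E D) :
    (N.ineqMat m).IsHermitian := by
  rcases m with ⟨n, r⟩ | ⟨k, r⟩ | ⟨l, r⟩
  · fin_cases r
    · exact (single_isHermitian n).neg
    · exact single_isHermitian n
  · fin_cases r
    · exact absSqMat_isHermitian _
    · exact absSqMat_isHermitian _
    · exact (isHermitian_ofReal_smul (single_isHermitian _) _).sub (single_isHermitian _)
    · exact (single_isHermitian _).sub (isHermitian_ofReal_smul (single_isHermitian _) _)
    · exact crossMat_isHermitian _ _ _
    · exact crossMat_isHermitian _ _ _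
    · exact crossMat_isHermitian _ _ _
  · exact Matrix.isHermitian_zero

theorem selMat_mul_mul_apply (N : HybridGrid V E D) (k : E) (Z : Matrix (Fin 2) (Fin 2) ℂ)
    (a b : V) : (N.selMat k * Z * (N.selMat k)ᵀ) a b =
      ∑ s, ∑ r, (if a = ![N.acSrc k, N.acDst k] r then 1 else 0) * Z r s *
        (if b = ![N.acSrc k, N.acDst k] s then 1 else 0) := by
  simp only [Matrix.mul_apply, selMat, Matrix.of_apply, Matrix.transpose_apply, Finset.sum_mul]

theorem selMat_mul_mul_eq_zero (N : HybridGrid V E D) {k : E} (Z : Matrix (Fin 2) (Fin 2) ℂ)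
    {a b : V} (h : ¬(N.OnBranch k a ∧ N.OnBranch k b)) :
    (N.selMat k * Z * (N.selMat k)ᵀ) a b = 0 := by
  rw [selMat_mul_mul_apply]
  simp only [OnBranch] at h
  simp only [Fin.sum_univ_two, Matrix.cons_val_zero, Matrix.cons_val_one]
  by_cases h1 : a = N.acSrc k <;> by_cases h2 : a = N.acDst k <;>
    by_cases h3 : b = N.acSrc k <;> by_cases h4 : b = N.acDst k <;> simp_all

theorem selMat_mul_mul_isHermitian (N : HybridGrid V E D) (k : E) {Z : Matrix (Fin 2) (Fin 2) ℂ}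
    (hZ : Z.IsHermitian) : (N.selMat k * Z * (N.selMat k)ᵀ).IsHermitian := by
  have : (N.selMat k)ᵀ = (N.selMat k)ᴴ := by
    ext i j
    simp only [selMat, Matrix.transpose_apply, Matrix.conjTranspose_apply, Matrix.of_apply]
    split_ifs <;> simp
  rw [this]
  exact Matrix.isHermitian_mul_mul_conjTranspose _ hZ

theorem branchMat_apply [Fintype V] (N : HybridGrid V E D) (k : E) (X : Matrix V V ℂ)
    (r s : Fin 2) :
    N.branchMat k X r s = X (![N.acSrc k, N.acDst k] r) (![N.acSrc k, N.acDst k] s) := by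
  simp [branchMat, Matrix.mul_apply, selMat]

theorem branchMat_isHermitian [Fintype V] (N : HybridGrid V E D) (k : E) {X : Matrix V V ℂ}
    (hX : X.IsHermitian) : (N.branchMat k X).IsHermitian := by
  ext r s
  rw [Matrix.conjTranspose_apply, branchMat_apply, branchMat_apply, hX.apply]

theorem trace_selMat_mul_mul_mul [Fintype V] (N : HybridGrid V E D) (k : E)
    (Z : Matrix (Fin 2) (Fin 2) ℂ) (X : Matrix V V ℂ) :
    (N.selMat k * Z * (N.selMat k)ᵀ * X).trace = (Z * N.branchMat k X).trace := by
  rw [branchMat, Matrix.mul_assoc, Matrix.mul_assoc, Matrix.trace_mul_comm, Matrix.mul_assoc,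
    Matrix.mul_assoc]

variable [Fintype E]

theorem admittance_apply (N : HybridGrid V E D) (a b : V) :
    N.admittance a b = (if a = b then N.yBus a else 0) +
      ∑ k, ((if N.acSrc k = a then N.currentSrc k b else 0) +
        (if N.acDst k = a then N.currentDst k b else 0)) := by
  simp only [admittance, Matrix.add_apply, Matrix.diagonal_apply, Matrix.sum_apply,
    Matrix.vecMulVec_apply, Pi.single_apply, ite_mul, one_mul, zero_mul, eq_comm]

theorem admittance_apply_eq_zero (N : HybridGrid V E D) (hdiag : ∀ n, (n, n) ∈ N.pattern)
    {a b : V} (h : (a, b) ∉ N.pattern) : N.admittance a b = 0 := by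
  have hab : a ≠ b := fun hab => h (hab ▸ hdiag a)
  rw [admittance_apply, if_neg hab, zero_add]
  refine Finset.sum_eq_zero fun k _ => ?_
  have h1 : (if N.acSrc k = a then N.currentSrc k b else 0) = 0 := by
    by_contra hn
    rw [ite_eq_right_iff, Classical.not_imp] at hn
    exact h ⟨k, .inl hn.1.symm, N.onBranch_of_currentSrc_ne_zero hn.2⟩
  have h2 : (if N.acDst k = a then N.currentDst k b else 0) = 0 := by
    by_contra hn
    rw [ite_eq_right_iff, Classical.not_imp] at hn
    exact h ⟨k, .inr hn.1.symm, N.onBranch_of_currentDst_ne_zero hn.2⟩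
  rw [h1, h2, add_zero]

theorem admittance_src_dst {N : HybridGrid V E D} (h : N.IsHybridArchitecture) (k : E) :
    N.admittance (N.acSrc k) (N.acDst k) = -(N.ratio k * N.ySeries k) := by
  have hl := h.no_loop k
  rw [admittance_apply, if_neg hl, zero_add, Finset.sum_eq_single k]
  · simp [hl.symm, currentSrc]
  · intro k' _ hk'
    have h1 : (if N.acSrc k' = N.acSrc k then N.currentSrc k' (N.acDst k) else 0) = 0 := by
      by_contra hn
      rw [ite_eq_right_iff, Classical.not_imp] at hn
      exact hk' (h.eq_of_onBranch (.inl hn.1.symm) (N.onBranch_of_currentSrc_ne_zero hn.2))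
    have h2 : (if N.acDst k' = N.acSrc k then N.currentDst k' (N.acDst k) else 0) = 0 := by
      by_contra hn
      rw [ite_eq_right_iff, Classical.not_imp] at hn
      exact hk' (h.eq_of_onBranch (.inr hn.1.symm) (N.onBranch_of_currentDst_ne_zero hn.2))
    rw [h1, h2, add_zero]
  · simp

theorem admittance_dst_src {N : HybridGrid V E D} (h : N.IsHybridArchitecture) (k : E) :
    N.admittance (N.acDst k) (N.acSrc k) = -(conj (N.ratio k) * N.ySeries k) := by
  have hl := h.no_loop k
  rw [admittance_apply, if_neg hl.symm, zero_add, Finset.sum_eq_single k]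
  · simp [hl, currentDst]
  · intro k' _ hk'
    have h1 : (if N.acSrc k' = N.acDst k then N.currentSrc k' (N.acSrc k) else 0) = 0 := by
      by_contra hn
      rw [ite_eq_right_iff, Classical.not_imp] at hn
      exact hk' (h.eq_of_onBranch (N.onBranch_of_currentSrc_ne_zero hn.2) (.inl hn.1.symm))
    have h2 : (if N.acDst k' = N.acDst k then N.currentDst k' (N.acSrc k) else 0) = 0 := by
      by_contra hn
      rw [ite_eq_right_iff, Classical.not_imp] at hn
      exact hk' (h.eq_of_onBranch (N.onBranch_of_currentDst_ne_zero hn.2) (.inr hn.1.symm))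
    rw [h1, h2, add_zero]
  · simp

/-- Lets the dual equality constraint be solved for the off-diagonal entry of `Z k`. -/
theorem sum_selMat_mul_mul_src_dst {N : HybridGrid V E D} (h : N.IsHybridArchitecture)
    (Z : E → Matrix (Fin 2) (Fin 2) ℂ) (k : E) :
    (∑ k', N.selMat k' * Z k' * (N.selMat k')ᵀ) (N.acSrc k) (N.acDst k) = Z k 0 1 := by
  have hl := h.no_loop k
  rw [Matrix.sum_apply, Finset.sum_eq_single k]
  · simp [selMat_mul_mul_apply, Fin.sum_univ_two, hl, hl.symm]
  · exact fun k' _ hk' => N.selMat_mul_mul_eq_zero _ fun hb => hk' (h.eq_of_onBranch hb.1 hb.2)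
  · simp

variable [Fintype V]

theorem powerMat_apply (N : HybridGrid V E D) (n a b : V) :
    N.powerMat n a b = if n = b then conj (N.admittance n a) else 0 := by
  by_cases h : n = b
  · subst h
    simp [powerMat, Matrix.conjTranspose_apply]
  · simp [powerMat, h, Ne.symm h]

theorem activeMat_apply (N : HybridGrid V E D) (n a b : V) :
    N.activeMat n a b = (1 / 2 : ℂ) * ((if n = b then conj (N.admittance n a) else 0) +
      if n = a then N.admittance n b else 0) := by
  simp only [activeMat, Matrix.smul_apply, Matrix.add_apply, Matrix.conjTranspose_apply,
    powerMat_apply, smul_eq_mul]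
  split_ifs <;> simp

theorem reactiveMat_apply (N : HybridGrid V E D) (n a b : V) :
    N.reactiveMat n a b = 1 / (2 * Complex.I) * ((if n = b then conj (N.admittance n a) else 0) -
      if n = a then N.admittance n b else 0) := by
  simp only [reactiveMat, Matrix.smul_apply, Matrix.sub_apply, Matrix.conjTranspose_apply,
    powerMat_apply, smul_eq_mul]
  split_ifs <;> simp

theorem activeMat_isHermitian (N : HybridGrid V E D) (n : V) : (N.activeMat n).IsHermitian := by
  ext a b
  simp only [Matrix.conjTranspose_apply, activeMat_apply]
  split_ifs <;> simp [add_comm]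

theorem reactiveMat_isHermitian (N : HybridGrid V E D) (n : V) : (N.reactiveMat n).IsHermitian := by
  ext a b
  simp only [Matrix.conjTranspose_apply, reactiveMat_apply]
  split_ifs <;> simp <;> ring

theorem activeMat_apply_eq_zero (N : HybridGrid V E D) (hdiag : ∀ n, (n, n) ∈ N.pattern) (n : V)
    {a b : V} (h : (a, b) ∉ N.pattern) : N.activeMat n a b = 0 := by
  have h1 := N.admittance_apply_eq_zero hdiag h
  have h2 := N.admittance_apply_eq_zero hdiag fun h' => h (N.pattern_symm h')
  rw [activeMat_apply]
  split_ifs <;> simp_all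

theorem reactiveMat_apply_eq_zero (N : HybridGrid V E D) (hdiag : ∀ n, (n, n) ∈ N.pattern) (n : V)
    {a b : V} (h : (a, b) ∉ N.pattern) : N.reactiveMat n a b = 0 := by
  have h1 := N.admittance_apply_eq_zero hdiag h
  have h2 := N.admittance_apply_eq_zero hdiag fun h' => h (N.pattern_symm h')
  rw [reactiveMat_apply]
  split_ifs <;> simp_all

variable [Fintype D]

theorem dualMat_isHermitian (N : HybridGrid V E D) (L : V → Fin 2 → ℝ) (μ : IneqIdx V E D → ℝ) :
    (N.dualMat L μ).IsHermitian := by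
  refine (isHermitian_sum _ fun n => ?_).add (isHermitian_sum _ fun m => ?_)
  · exact (isHermitian_ofReal_smul (N.activeMat_isHermitian n) _).add
      (isHermitian_ofReal_smul (N.reactiveMat_isHermitian n) _)
  · exact isHermitian_ofReal_smul (N.ineqMat_isHermitian m) _

theorem dualMat_apply (N : HybridGrid V E D) (L : V → Fin 2 → ℝ) (μ : IneqIdx V E D → ℝ)
    (a b : V) : N.dualMat L μ a b =
      ∑ n, (L n 0 * N.activeMat n a b + L n 1 * N.reactiveMat n a b) +
        ∑ m, μ m * N.ineqMat m a b := by
  simp only [dualMat, Matrix.add_apply, Matrix.sum_apply, Matrix.smul_apply, smul_eq_mul]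

theorem dualMat_apply_eq_zero (N : HybridGrid V E D) (hdiag : ∀ n, (n, n) ∈ N.pattern)
    (L : V → Fin 2 → ℝ) (μ : IneqIdx V E D → ℝ) {a b : V} (h : (a, b) ∉ N.pattern) :
    N.dualMat L μ a b = 0 := by
  simp [dualMat_apply, N.activeMat_apply_eq_zero hdiag _ h, N.reactiveMat_apply_eq_zero hdiag _ h,
    N.ineqMat_apply_eq_zero hdiag _ h]

/-- The off-diagonal entry of the dual matrix at an AC branch. -/
theorem dualMat_src_dst {N : HybridGrid V E D} (h : N.IsHybridArchitecture)
    (L : V → Fin 2 → ℝ) (μ : IneqIdx V E D → ℝ) (k : E) :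
    N.dualMat L μ (N.acSrc k) (N.acDst k) =
      -N.ratio k * (((L (N.acSrc k) 0 + L (N.acSrc k) 1 * Complex.I) * N.ySeries k
          + (L (N.acDst k) 0 - L (N.acDst k) 1 * Complex.I) * conj (N.ySeries k)) / 2
        + (μ (.inr (.inl (k, 0))) * Complex.normSq (N.ratioSrc k) : ℝ)
            * conj (conj (N.ySeries k) * (N.ySeries k + N.yShuntSrc k))
        + (μ (.inr (.inl (k, 1))) * Complex.normSq (N.ratioDst k) : ℝ)
            * (conj (N.ySeries k) * (N.ySeries k + N.yShuntDst k)))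
      + (-μ (.inr (.inl (k, 4)))
        + μ (.inr (.inl (k, 5))) * (Real.tan (N.angleMin k) + Complex.I)
        - μ (.inr (.inl (k, 6))) * (Real.tan (N.angleMax k) + Complex.I)) / 2 := by
  have hl := h.no_loop k
  have hpow : ∑ n, ((L n 0 : ℂ) * N.activeMat n (N.acSrc k) (N.acDst k)
      + L n 1 * N.reactiveMat n (N.acSrc k) (N.acDst k)) =
      -N.ratio k * (((L (N.acSrc k) 0 + L (N.acSrc k) 1 * Complex.I) * N.ySeries k
          + (L (N.acDst k) 0 - L (N.acDst k) 1 * Complex.I) * conj (N.ySeries k)) / 2) := by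
    simp only [activeMat_apply, reactiveMat_apply, Finset.sum_add_distrib, mul_add, mul_sub,
      Finset.sum_sub_distrib, mul_ite, mul_zero, Finset.sum_ite_eq', Finset.mem_univ, if_true,
      admittance_src_dst h, admittance_dst_src h]
    simp [Complex.inv_I]
    ring
  have hineq : ∑ m, (μ m : ℂ) * N.ineqMat m (N.acSrc k) (N.acDst k) =
      ∑ r, (μ (.inr (.inl (k, r))) : ℂ) * N.ineqMat (.inr (.inl (k, r)))
        (N.acSrc k) (N.acDst k) := by
    rw [Fintype.sum_sum_type, Fintype.sum_sum_type, Finset.sum_eq_zero, zero_add, add_eq_left.2,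
      Fintype.sum_prod_type, Finset.sum_eq_single k]
    · intro k' _ hk'
      refine Finset.sum_eq_zero fun r _ => ?_
      rw [N.ineqMat_branch_eq_zero r fun hb => hk' (h.eq_of_onBranch hb.1 hb.2), mul_zero]
    · simp
    · simp [ineqMat]
    · rintro ⟨n, r⟩ -
      have : Matrix.single n n (1 : ℂ) (N.acSrc k) (N.acDst k) = 0 :=
        Matrix.single_apply_of_ne _ _ _ _ _ fun hn => hl (hn.1.symm.trans hn.2)
      fin_cases r <;> simp [ineqMat, this]
  rw [dualMat_apply, hpow, hineq, Fin.sum_univ_seven]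
  simp [ineqMat, absSqMat, crossMat, Matrix.vecMulVec_apply, currentSrc, currentDst,
    hl, hl.symm]
  ring

/-- With positive active and nonnegative reactive power prices, the off-diagonal entries of the dual
matrix at the AC branches do not vanish. -/
theorem dualMat_src_dst_ne_zero {N : HybridGrid V E D} (hphys : N.IsPhysical)
    (h : N.IsHybridArchitecture) (L : V → Fin 2 → ℝ) (μ : IneqIdx V E D → ℝ) (hμ : ∀ m, 0 ≤ μ m)
    (hactive : ∀ n, 0 < L n 0) (hreactive : ∀ n, 0 ≤ L n 1) (k : E) :
    N.dualMat L μ (N.acSrc k) (N.acDst k) ≠ 0 := by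
  rw [dualMat_src_dst h]
  have hρ : N.ratio k ≠ 0 :=
    mul_ne_zero ((map_ne_zero _).2 (hphys.ratioSrc_ne k)) (hphys.ratioDst_ne k)
  set A : ℂ := ((L (N.acSrc k) 0 + L (N.acSrc k) 1 * Complex.I) * N.ySeries k
          + (L (N.acDst k) 0 - L (N.acDst k) 1 * Complex.I) * conj (N.ySeries k)) / 2
        + (μ (.inr (.inl (k, 0))) * Complex.normSq (N.ratioSrc k) : ℝ)
            * conj (conj (N.ySeries k) * (N.ySeries k + N.yShuntSrc k))
        + (μ (.inr (.inl (k, 1))) * Complex.normSq (N.ratioDst k) : ℝ)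
            * (conj (N.ySeries k) * (N.ySeries k + N.yShuntDst k)) with hAdef
  -- Each end contributes half of Λ₁ Re y - Λ₂ Im y, which is positive; the current-limit terms are
  -- nonnegative by the shunt assumption.
  have hA : 0 < A.re := by
    have h1 : 0 < (((L (N.acSrc k) 0 + L (N.acSrc k) 1 * Complex.I) * N.ySeries k
          + (L (N.acDst k) 0 - L (N.acDst k) 1 * Complex.I) * conj (N.ySeries k)) / 2).re := by
      have ha := mul_pos (hactive (N.acSrc k)) (hphys.lossy k)
      have hb := mul_pos (hactive (N.acDst k)) (hphys.lossy k)
      have hc := mul_nonneg (hreactive (N.acSrc k)) (neg_nonneg.2 (hphys.inductive_ k))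
      have hd := mul_nonneg (hreactive (N.acDst k)) (neg_nonneg.2 (hphys.inductive_ k))
      simp
      linarith
    rw [hAdef, Complex.add_re, Complex.add_re, Complex.re_ofReal_mul, Complex.re_ofReal_mul,
      Complex.conj_re]
    have h2 := mul_nonneg (mul_nonneg (hμ (.inr (.inl (k, 0)))) (Complex.normSq_nonneg
      (N.ratioSrc k))) (hphys.shuntSrc k)
    have h3 := mul_nonneg (mul_nonneg (hμ (.inr (.inl (k, 1)))) (Complex.normSq_nonneg
      (N.ratioDst k))) (hphys.shuntDst k)
    linarith
  clear_value A
  intro hzero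
  set ρ := N.ratio k
  have hθ1 : -(Real.pi / 2) < -ρ.arg := (hphys.angleMin_gt k).trans_le (hphys.angleMin_le k)
  have hθ2 : -ρ.arg < Real.pi / 2 := (hphys.le_angleMax k).trans_lt (hphys.angleMax_lt k)
  -- As -arg ρ lies in the angle range, Re ρ > 0 and monotonicity of the tangent turns the range
  -- into t₁ Re ρ + Im ρ ≤ 0 ≤ t₂ Re ρ + Im ρ.
  have hre : 0 < ρ.re := Complex.abs_arg_lt_pi_div_two_iff.1 (abs_lt.2 ⟨by linarith, by linarith⟩)
    |>.resolve_right hρ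
  have htan : Real.tan (-ρ.arg) = -(ρ.im / ρ.re) := by rw [Real.tan_neg, Complex.tan_arg]
  have hmin : Real.tan (N.angleMin k) * ρ.re + ρ.im ≤ 0 := by
    have : Real.tan (N.angleMin k) ≤ Real.tan (-ρ.arg) :=
      Real.strictMonoOn_tan.monotoneOn ⟨hphys.angleMin_gt k, (hphys.angleMin_le k).trans_lt hθ2⟩
        ⟨hθ1, hθ2⟩ (hphys.angleMin_le k)
    rw [htan, ← neg_div, le_div_iff₀ hre] at this
    linarith
  have hmax : 0 ≤ Real.tan (N.angleMax k) * ρ.re + ρ.im := by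
    have : Real.tan (-ρ.arg) ≤ Real.tan (N.angleMax k) :=
      Real.strictMonoOn_tan.monotoneOn ⟨hθ1, hθ2⟩
        ⟨hθ1.trans_le (hphys.le_angleMax k), hphys.angleMax_lt k⟩ (hphys.le_angleMax k)
    rw [htan, ← neg_div, div_le_iff₀ hre] at this
    linarith
  generalize Real.tan (N.angleMin k) = t₁, Real.tan (N.angleMax k) = t₂ at hmin hmax hzero
  -- Since Re(ρ*(t + i)) = t Re ρ + Im ρ, all three angle multipliers now contribute nonpositive
  -- terms, next to -|ρ|² Re A < 0.
  have hmul := congrArg (fun z => (conj ρ * z).re) hzero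
  simp at hmul
  have hnorm : 0 < ρ.re * ρ.re + ρ.im * ρ.im := by nlinarith [mul_self_nonneg ρ.im]
  have h4 := mul_nonneg (hμ (.inr (.inl (k, 4)))) hre.le
  have h5 := mul_nonneg (hμ (.inr (.inl (k, 5)))) (neg_nonneg.2 hmin)
  have h6 := mul_nonneg (hμ (.inr (.inl (k, 6)))) hmax
  have h7 := mul_pos hnorm hA
  nlinarith

end Matrices

end HybridGrid

/-! ### Slopes of bounded affine functions and coordinates of linear functionals. -/

theorem nonneg_of_forall_nonneg_add_mul {a b : ℝ} (h : ∀ R : ℝ, 0 ≤ R → 0 ≤ a + R * b) : 0 ≤ b := by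
  by_contra! hb
  -- At this `R` the value is `a - |a| + b`, which is negative.
  have h1 := h (|a| / -b + 1) (by have := div_nonneg (abs_nonneg a) (neg_nonneg.2 hb.le); linarith)
  have h2 : |a| / -b * b = -|a| := by
    rw [div_neg, neg_mul, div_mul_cancel₀ _ hb.ne]
  rw [add_mul, h2] at h1
  linarith [le_abs_self a]

theorem eq_zero_of_forall_le_mul {a b : ℝ} (h : ∀ R : ℝ, a ≤ R * b) : b = 0 := by
  refine le_antisymm ?_ ?_
  · refine neg_nonneg.1 (nonneg_of_forall_nonneg_add_mul (a := -a) fun R _ => ?_)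
    linarith [h (-R)]
  · refine nonneg_of_forall_nonneg_add_mul (a := -a) fun R _ => ?_
    linarith [h R]

theorem LinearMap.exists_dotProduct {ι : Type*} [Fintype ι] (l : (ι → ℝ) →ₗ[ℝ] ℝ) :
    ∃ c : ι → ℝ, ∀ x, l x = c ⬝ᵥ x := by
  classical
  refine ⟨fun i => l fun j => if i = j then 1 else 0, fun x => ?_⟩
  rw [l.pi_apply_eq_sum_univ]
  simp [dotProduct, mul_comm]

theorem LinearMap.exists_sum_dotProduct {ι κ : Type*} [Fintype ι] [Fintype κ]
    (l : (ι → κ → ℝ) →ₗ[ℝ] ℝ) : ∃ c : ι → κ → ℝ, ∀ x, l x = ∑ i, c i ⬝ᵥ x i := by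
  classical
  choose c hc using fun i => (l ∘ₗ LinearMap.single ℝ (fun _ => κ → ℝ) i).exists_dotProduct
  refine ⟨c, fun x => ?_⟩
  simp only [← hc, LinearMap.comp_apply, LinearMap.single_apply, ← map_sum,
    Finset.univ_sum_single]

/-! ### Partial matrices, Slater points and strong duality. -/

namespace HybridGrid

variable {V E D : Type*}

theorem IsPartial.comb {N : HybridGrid V E D} {X X' : Matrix V V ℂ} (hX : N.IsPartial X)
    (hX' : N.IsPartial X') (a b : ℝ) : N.IsPartial (a • X + b • X') := by
  refine ⟨?_, fun i j hij => by simp [hX.2 i j hij, hX'.2 i j hij]⟩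
  rw [Matrix.IsHermitian, Matrix.conjTranspose_add, Matrix.conjTranspose_smul,
    Matrix.conjTranspose_smul, hX.1.eq, hX'.1.eq, star_trivial, star_trivial]

theorem isPartial_zero (N : HybridGrid V E D) : N.IsPartial 0 :=
  ⟨Matrix.isHermitian_zero, fun _ _ _ => rfl⟩

open Classical in
/-- The part of a matrix that belongs to the AC subgraph. -/
def mask (N : HybridGrid V E D) (X : Matrix V V ℂ) : Matrix V V ℂ :=
  Matrix.of fun a b => if (a, b) ∈ N.pattern then X a b else 0

theorem mask_isPartial (N : HybridGrid V E D) {X : Matrix V V ℂ} (hX : X.IsHermitian) :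
    N.IsPartial (N.mask X) := by
  refine ⟨?_, fun a b h => by simp [mask, h]⟩
  ext a b
  by_cases h : (a, b) ∈ N.pattern
  · simpa [mask, h, N.pattern_symm h] using hX.apply a b
  · have h' : (b, a) ∉ N.pattern := fun h' => h (N.pattern_symm h')
    simp [mask, h, h']

variable [Fintype V]

/-- The trace pairing with a matrix supported on the pattern sees only the pattern entries, so a
full matrix such as v vᴴ can be cut down to a partial one. -/
theorem trace_mul_mask (N : HybridGrid V E D) {A : Matrix V V ℂ}
    (hA : ∀ a b, (a, b) ∉ N.pattern → A a b = 0) (X : Matrix V V ℂ) :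
    (A * N.mask X).trace = (A * X).trace := by
  simp only [Matrix.trace, Matrix.diag_apply, Matrix.mul_apply]
  refine Finset.sum_congr rfl fun a _ => Finset.sum_congr rfl fun b _ => ?_
  by_cases h : (a, b) ∈ N.pattern
  · simp [mask, N.pattern_symm h]
  · simp [hA a b h]

theorem IsPhysical.welfare_comb_le {N : HybridGrid V E D} (hphys : N.IsPhysical)
    {g g' d d' : V → Fin 2 → ℝ} (hg : ∀ n, g n ∈ N.genSet n) (hg' : ∀ n, g' n ∈ N.genSet n)
    (hd : ∀ n, d n ∈ N.loadSet n) (hd' : ∀ n, d' n ∈ N.loadSet n) {a b : ℝ} (ha : 0 ≤ a)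
    (hb : 0 ≤ b) (hab : a + b = 1) :
    a * N.welfare g d + b * N.welfare g' d' ≤ N.welfare (a • g + b • g') (a • d + b • d') := by
  have h1 := Finset.sum_le_sum fun n (_ : n ∈ Finset.univ) =>
    (hphys.cost_convex n).2 (hg n) (hg' n) ha hb hab
  have h2 := Finset.sum_le_sum fun n (_ : n ∈ Finset.univ) =>
    (hphys.benefit_concave n).2 (hd n) (hd' n) ha hb hab
  simp only [smul_eq_mul, Finset.sum_add_distrib, ← Finset.mul_sum] at h1 h2
  simp only [welfare, Pi.add_apply, Pi.smul_apply]
  linarith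

variable [DecidableEq V]

/-- The real coordinates of the principal submatrix of an AC branch. -/
def branchCoord (N : HybridGrid V E D) (X : Matrix V V ℂ) (k : E) : Fin 4 → ℝ :=
  herm2Coord (N.branchMat k X)

theorem branchCoord_comb (N : HybridGrid V E D) (a b : ℝ) (X X' : Matrix V V ℂ) (k : E) :
    N.branchCoord (a • X + b • X') k = a • N.branchCoord X k + b • N.branchCoord X' k := by
  ext i
  fin_cases i <;> simp [branchCoord, herm2Coord, branchMat_apply]

theorem herm2_branchCoord (N : HybridGrid V E D) {X : Matrix V V ℂ} (hX : X.IsHermitian) (k : E) :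
    herm2 (N.branchCoord X k) = N.branchMat k X :=
  (N.branchMat_isHermitian k hX).herm2_herm2Coord

theorem branchCoord_mask (N : HybridGrid V E D) (X : Matrix V V ℂ) (k : E) :
    N.branchCoord (N.mask X) k = N.branchCoord X k := by
  have h : N.branchMat k (N.mask X) = N.branchMat k X := by
    ext r s
    have hmem : (![N.acSrc k, N.acDst k] r, ![N.acSrc k, N.acDst k] s) ∈ N.pattern := by
      refine ⟨k, ?_, ?_⟩
      · fin_cases r <;> simp
      · fin_cases s <;> simp
    rw [branchMat_apply, branchMat_apply, mask, Matrix.of_apply, if_pos hmem]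
  rw [branchCoord, h, branchCoord]

theorem sum_dotProduct_branchCoord [Fintype E] (N : HybridGrid V E D) (c : E → Fin 4 → ℝ) {X : Matrix V V ℂ}
    (hX : X.IsHermitian) : ∑ k, c k ⬝ᵥ N.branchCoord X k =
      ((∑ k, N.selMat k * herm2Dual (c k) * (N.selMat k)ᵀ) * X).trace.re := by
  simp only [Finset.sum_mul, Matrix.trace_sum, Complex.re_sum, trace_selMat_mul_mul_mul]
  refine Finset.sum_congr rfl fun k _ => ?_
  rw [← N.herm2_branchCoord hX k, trace_herm2Dual_mul_herm2]

variable [Fintype D]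

theorem ineqLhs_comb [DecidableEq D] (N : HybridGrid V E D) (a b : ℝ) (X X' : Matrix V V ℂ) (p p' : D → ℝ)
    (m : IneqIdx V E D) : N.ineqLhs (a • X + b • X') (a • p + b • p') m =
      a * N.ineqLhs X p m + b * N.ineqLhs X' p' m := by
  simp [ineqLhs, Matrix.mul_add, Matrix.trace_add, dotProduct_add, dotProduct_smul]
  ring

theorem ineqLhs_mask [DecidableEq D] (N : HybridGrid V E D) (hdiag : ∀ n, (n, n) ∈ N.pattern)
    (X : Matrix V V ℂ) (p : D → ℝ) (m : IneqIdx V E D) :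
    N.ineqLhs (N.mask X) p m = N.ineqLhs X p m := by
  rw [ineqLhs, ineqLhs, N.trace_mul_mask fun a b h => N.ineqMat_apply_eq_zero hdiag m h]

variable [Fintype E]

theorem injection_comb (N : HybridGrid V E D) (a b : ℝ) (X X' : Matrix V V ℂ) (p p' : D → ℝ)
    (n : V) : N.injection (a • X + b • X') (a • p + b • p') n =
      a • N.injection X p n + b • N.injection X' p' n := by
  ext i
  fin_cases i
  · simp [injection, Matrix.mul_add, Matrix.trace_add, dotProduct_add, dotProduct_smul]
    ring
  · simp [injection, Matrix.mul_add, Matrix.trace_add]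

theorem injection_mask (N : HybridGrid V E D) (hdiag : ∀ n, (n, n) ∈ N.pattern)
    (X : Matrix V V ℂ) (p : D → ℝ) (n : V) :
    N.injection (N.mask X) p n = N.injection X p n := by
  rw [injection, injection, N.trace_mul_mask fun a b h => N.activeMat_apply_eq_zero hdiag n h,
    N.trace_mul_mask fun a b h => N.reactiveMat_apply_eq_zero hdiag n h]

variable [DecidableEq D]

/-- Lagrangian pairing of the multipliers with the constraint functions. -/
theorem sum_dotProduct_injection_add (N : HybridGrid V E D) (L : V → Fin 2 → ℝ)
    (μ : IneqIdx V E D → ℝ) (X : Matrix V V ℂ) (p : D → ℝ) :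
    ∑ n, L n ⬝ᵥ N.injection X p n + ∑ m, μ m * N.ineqLhs X p m =
      (N.dualMat L μ * X).trace.re + N.dualVec L μ ⬝ᵥ p := by
  have h1 : (N.dualMat L μ * X).trace.re =
      ∑ n, (L n 0 * (N.activeMat n * X).trace.re + L n 1 * (N.reactiveMat n * X).trace.re)
        + ∑ m, μ m * (N.ineqMat m * X).trace.re := by
    simp only [dualMat, Matrix.add_mul, Finset.sum_mul, Matrix.trace_add, Matrix.trace_sum,
      Matrix.smul_mul, Matrix.trace_smul, Complex.add_re, Complex.re_sum, smul_eq_mul,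
      Complex.re_ofReal_mul]
  have h2 : N.dualVec L μ ⬝ᵥ p =
      ∑ n, L n 0 * (N.dcVec n ⬝ᵥ p) + ∑ m, μ m * (N.ineqVec m ⬝ᵥ p) := by
    simp only [dualVec, add_dotProduct, sum_dotProduct, smul_dotProduct, smul_eq_mul]
  rw [h1, h2]
  simp only [injection, ineqLhs, dotProduct, Fin.sum_univ_two, Matrix.cons_val_zero,
    Matrix.cons_val_one, Finset.sum_add_distrib, mul_add]
  ring

/-- Strict feasibility of the optimal power flow problem entails that of the relaxation, with
positive definite principal submatrices. -/
theorem StrictlyFeasible.exists_slater {N : HybridGrid V E D} (harch : N.IsHybridArchitecture)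
    (hdiag : ∀ n, (n, n) ∈ N.pattern) (hfeas : N.StrictlyFeasible) :
    ∃ (X : Matrix V V ℂ) (p : D → ℝ), N.IsPartial X ∧
      (∀ n, N.injection X p n ∈ interior (N.genSet n - N.loadSet n)) ∧
      (∀ m, N.ineqLhs X p m < N.ineqRhs m) ∧
      ∀ k, 0 < N.branchCoord X k 0 ∧ 0 < N.branchCoord X k 1 ∧
        N.branchCoord X k 2 ^ 2 + N.branchCoord X k 3 ^ 2 <
          N.branchCoord X k 0 * N.branchCoord X k 1 := by
  obtain ⟨v, p, g, d, -, -, hbal, hineq, hint⟩ := hfeas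
  -- The branch blocks of v vᴴ are singular, so a small multiple of the identity is added; the
  -- remaining strict conditions are open and survive.
  set W := Matrix.vecMulVec v (star v)
  have hcomb : ∀ ε : ℝ, (1 : ℝ) • W + ε • (1 : Matrix V V ℂ) = W + ε • 1 ∧
      (1 : ℝ) • p + ε • (0 : D → ℝ) = p := fun ε => by simp
  have hinj : ∀ (ε : ℝ) n, N.injection (W + ε • 1) p n =
      N.injection W p n + ε • N.injection 1 0 n := fun ε n => by
    have := N.injection_comb 1 ε W 1 p 0 n
    rwa [(hcomb ε).1, (hcomb ε).2, one_smul] at this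
  have hlhs : ∀ (ε : ℝ) m, N.ineqLhs (W + ε • 1) p m =
      N.ineqLhs W p m + ε * N.ineqLhs 1 0 m := fun ε m => by
    have := N.ineqLhs_comb 1 ε W 1 p 0 m
    rwa [(hcomb ε).1, (hcomb ε).2, one_mul] at this
  have ev1 : ∀ᶠ ε : ℝ in nhdsWithin 0 (Set.Ioi 0), ∀ n,
      N.injection (W + ε • 1) p n ∈ interior (N.genSet n - N.loadSet n) := by
    refine Filter.eventually_all.2 fun n => Filter.Eventually.filter_mono nhdsWithin_le_nhds ?_
    have hc : Continuous fun ε : ℝ => N.injection W p n + ε • N.injection 1 0 n := by fun_prop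
    simp only [hinj]
    refine hc.continuousAt.eventually_mem (isOpen_interior.mem_nhds ?_)
    simpa [hbal] using hint n
  have ev2 : ∀ᶠ ε : ℝ in nhdsWithin 0 (Set.Ioi 0), ∀ m,
      N.ineqLhs (W + ε • 1) p m < N.ineqRhs m := by
    refine Filter.eventually_all.2 fun m => Filter.Eventually.filter_mono nhdsWithin_le_nhds ?_
    have hc : Continuous fun ε : ℝ => N.ineqLhs W p m + ε * N.ineqLhs 1 0 m := by fun_prop
    simp only [hlhs]
    refine hc.continuousAt.eventually_lt_const ?_
    simpa using hineq m
  obtain ⟨ε, ⟨h1, h2⟩, hε⟩ := ((ev1.and ev2).and self_mem_nhdsWithin).exists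
  have hε : 0 < ε := hε
  have hherm : (W + ε • (1 : Matrix V V ℂ)).IsHermitian := by
    refine (Matrix.posSemidef_vecMulVec_self_star v).isHermitian.add ?_
    rw [Matrix.IsHermitian, Matrix.conjTranspose_smul, Matrix.conjTranspose_one, star_trivial]
  refine ⟨N.mask (W + ε • 1), p, N.mask_isPartial hherm, fun n => ?_, fun m => ?_, fun k => ?_⟩
  · rw [N.injection_mask hdiag]
    exact h1 n
  · rw [N.ineqLhs_mask hdiag]
    exact h2 m
  · have hl := harch.no_loop k
    have ha := Complex.normSq_nonneg (v (N.acSrc k))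
    have hb := Complex.normSq_nonneg (v (N.acDst k))
    rw [Complex.normSq_apply] at ha hb
    rw [branchCoord_mask]
    simp only [branchCoord, herm2Coord, branchMat_apply, Matrix.cons_val,
      Matrix.add_apply, Matrix.smul_apply, Matrix.one_apply_eq, Matrix.one_apply_ne hl, W,
      Matrix.vecMulVec_apply, Pi.star_apply, Complex.star_def, Complex.add_re, Complex.add_im,
      Complex.mul_re, Complex.mul_im, Complex.conj_re, Complex.conj_im, Complex.smul_re,
      Complex.smul_im, Complex.one_re, Complex.zero_re, Complex.zero_im, smul_eq_mul]
    generalize (v (N.acSrc k)).re = a, (v (N.acSrc k)).im = b, (v (N.acDst k)).re = c,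
      (v (N.acDst k)).im = e at *
    have hab := mul_nonneg hε.le ha
    have hce := mul_nonneg hε.le hb
    refine ⟨by nlinarith, by nlinarith, ?_⟩
    -- The determinant of the block is ε(|v_i|² + |v_j|²) + ε².
    have := mul_pos hε hε
    nlinarith

/-! ### Strong duality -/

/-- The attainable values of the objective (relative to `w`) and of the perturbations of the
constraints of the relaxation. -/
def perturbationSet (N : HybridGrid V E D) (w : ℝ) :
    Set (ℝ × (V → Fin 2 → ℝ) × (IneqIdx V E D → ℝ) × (E → Fin 4 → ℝ)) :=
  {x | ∃ (X : Matrix V V ℂ) (p : D → ℝ) (g d : V → Fin 2 → ℝ), N.IsPartial X ∧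
    (∀ n, g n ∈ N.genSet n) ∧ (∀ n, d n ∈ N.loadSet n) ∧ x.1 ≤ N.welfare g d - w ∧
    (∀ n, x.2.1 n = N.injection X p n - (g n - d n)) ∧
    (∀ m, N.ineqLhs X p m - N.ineqRhs m ≤ x.2.2.1 m) ∧
    ∀ k, (herm2 (N.branchCoord X k + x.2.2.2 k)).PosSemidef}

/-- The constraint functions are affine in X, p, g, d, the welfare is concave, and the semidefinite
cone is convex. -/
theorem IsPhysical.convex_perturbationSet {N : HybridGrid V E D} (hphys : N.IsPhysical) (w : ℝ) :
    Convex ℝ (N.perturbationSet w) := by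
  rintro ⟨t, u, s, z⟩ ⟨X, p, g, d, hX, hg, hd, ht, hu, hs, hz⟩ ⟨t', u', s', z'⟩
    ⟨X', p', g', d', hX', hg', hd', ht', hu', hs', hz'⟩ a b ha hb hab
  refine ⟨a • X + b • X', a • p + b • p', a • g + b • g', a • d + b • d', hX.comb hX' a b,
    fun n => (hphys.cost_convex n).1 (hg n) (hg' n) ha hb hab,
    fun n => (hphys.benefit_concave n).1 (hd n) (hd' n) ha hb hab, ?_, fun n => ?_, fun m => ?_,
    fun k => ?_⟩
  · have h1 := hphys.welfare_comb_le hg hg' hd hd' ha hb hab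
    have h2 := mul_le_mul_of_nonneg_left ht ha
    have h3 := mul_le_mul_of_nonneg_left ht' hb
    have h4 : a * w + b * w = w := by rw [← add_mul, hab, one_mul]
    simp only [Prod.fst_add, Prod.smul_fst, smul_eq_mul] at h2 h3 ⊢
    linarith
  · have h1 := hu n
    have h2 := hu' n
    simp only [Prod.snd_add, Prod.smul_snd, Prod.fst_add, Prod.smul_fst, Pi.add_apply,
      Pi.smul_apply] at h1 h2 ⊢
    rw [h1, h2, injection_comb]
    module
  · have h1 := mul_le_mul_of_nonneg_left (hs m) ha
    have h2 := mul_le_mul_of_nonneg_left (hs' m) hb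
    have h4 : a * N.ineqRhs m + b * N.ineqRhs m = N.ineqRhs m := by rw [← add_mul, hab, one_mul]
    simp only [Prod.snd_add, Prod.smul_snd, Prod.fst_add, Prod.smul_fst, Pi.add_apply,
      Pi.smul_apply, smul_eq_mul] at h1 h2 ⊢
    rw [ineqLhs_comb]
    linarith
  · have h1 : herm2 (N.branchCoord (a • X + b • X') k + (a • z + b • z') k) =
        a • herm2 (N.branchCoord X k + z k) + b • herm2 (N.branchCoord X' k + z' k) := by
      rw [← herm2_smul, ← herm2_smul, ← herm2_add, branchCoord_comb]
      congr 1
      simp only [Pi.add_apply, Pi.smul_apply]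
      module
    simp only [Prod.snd_add, Prod.smul_snd]
    rw [h1]
    exact ((hz k).smul ha).add ((hz' k).smul hb)

/-- Existence of Lagrange multipliers. -/
theorem SOCOptimal.exists_multipliers {N : HybridGrid V E D} (hphys : N.IsPhysical)
    (harch : N.IsHybridArchitecture) (hdiag : ∀ n, (n, n) ∈ N.pattern)
    (hfeas : N.StrictlyFeasible) {X : Matrix V V ℂ} {p : D → ℝ} {g d : V → Fin 2 → ℝ}
    (hopt : N.SOCOptimal X p g d) :
    ∃ (L : V → Fin 2 → ℝ) (μ : IneqIdx V E D → ℝ) (c : E → Fin 4 → ℝ),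
      ∀ t u s z, (t, u, s, z) ∈ N.perturbationSet (N.welfare g d) →
        t ≤ ∑ n, L n ⬝ᵥ u n + μ ⬝ᵥ s + ∑ k, c k ⬝ᵥ z k := by
  obtain ⟨l, hl⟩ := (hphys.convex_perturbationSet (N.welfare g d)).exists_supergradient (by
    rintro t ⟨X', p', g', d', hX', hg', hd', ht, hu, hs, hz⟩
    refine ht.trans (sub_nonpos.2 (hopt.2 X' p' g' d' ⟨hX', hg', hd', fun n => ?_, fun m => ?_,
      fun k => ?_⟩))
    · exact sub_eq_zero.1 (hu n).symm
    · exact sub_nonpos.1 (hs m)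
    · rw [← N.herm2_branchCoord hX'.1]
      simpa using hz k) (by
    -- With X' and p' fixed, every small perturbation is attainable: that of the balance is absorbed
    -- by g' and d', as the injection is interior to the difference set, the others by slack.
    obtain ⟨X', p', hX', hinj, hlt, hpd⟩ := hfeas.exists_slater harch hdiag
    have e1 : ∀ᶠ y : (V → Fin 2 → ℝ) × (IneqIdx V E D → ℝ) × (E → Fin 4 → ℝ) in nhds 0, ∀ n,
        N.injection X' p' n - y.1 n ∈ interior (N.genSet n - N.loadSet n) := by
      refine Filter.eventually_all.2 fun n => ?_
      refine ContinuousAt.eventually_mem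
        (f := fun y : (V → Fin 2 → ℝ) × (IneqIdx V E D → ℝ) × (E → Fin 4 → ℝ) =>
          N.injection X' p' n - y.1 n) (by fun_prop) (isOpen_interior.mem_nhds ?_)
      simpa using hinj n
    have e2 : ∀ᶠ y : (V → Fin 2 → ℝ) × (IneqIdx V E D → ℝ) × (E → Fin 4 → ℝ) in nhds 0, ∀ m,
        N.ineqLhs X' p' m - N.ineqRhs m < y.2.1 m := by
      refine Filter.eventually_all.2 fun m => ?_
      have hc : Continuous fun y : (V → Fin 2 → ℝ) × (IneqIdx V E D → ℝ) × (E → Fin 4 → ℝ) =>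
          y.2.1 m := by fun_prop
      exact hc.continuousAt.eventually_const_lt (sub_neg.2 (hlt m))
    have e3 : ∀ᶠ y : (V → Fin 2 → ℝ) × (IneqIdx V E D → ℝ) × (E → Fin 4 → ℝ) in nhds 0, ∀ k,
        (herm2 (N.branchCoord X' k + y.2.2 k)).PosSemidef := by
      refine Filter.eventually_all.2 fun k => ?_
      have hc : Continuous fun y : (V → Fin 2 → ℝ) × (IneqIdx V E D → ℝ) × (E → Fin 4 → ℝ) =>
          N.branchCoord X' k + y.2.2 k := by fun_prop
      refine (hc.tendsto' 0 (N.branchCoord X' k) (by simp)).eventually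
        (eventually_posSemidef_herm2 (hpd k).1 (hpd k).2.1 (hpd k).2.2)
    filter_upwards [e1, e2, e3] with y h1 h2 h3
    have hgd : ∀ n, ∃ g' ∈ N.genSet n, ∃ d' ∈ N.loadSet n, g' - d' = N.injection X' p' n - y.1 n :=
      fun n => Set.mem_sub.1 (interior_subset (h1 n))
    choose g' hg' d' hd' hgd using hgd
    exact ⟨_, X', p', g', d', hX', hg', hd', le_rfl, fun n => by rw [hgd, sub_sub_cancel],
      fun m => (h2 m).le, h3⟩)
  obtain ⟨L, hL⟩ := (l ∘ₗ LinearMap.inl ℝ _ _).exists_sum_dotProduct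
  obtain ⟨μ, hμ⟩ := (l ∘ₗ LinearMap.inr ℝ _ _ ∘ₗ LinearMap.inl ℝ _ _).exists_dotProduct
  obtain ⟨c, hc⟩ := (l ∘ₗ LinearMap.inr ℝ _ _ ∘ₗ LinearMap.inr ℝ _ _).exists_sum_dotProduct
  refine ⟨L, μ, c, fun t u s z h => (hl t _ h).trans_eq ?_⟩
  rw [← hL, ← hμ, ← hc]
  simp only [LinearMap.comp_apply, LinearMap.inl_apply, LinearMap.inr_apply, ← map_add]
  simp

/-- Strong duality: some dual feasible point attains the primal optimal value. -/
theorem SOCOptimal.exists_dualFeasible {N : HybridGrid V E D} (hphys : N.IsPhysical)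
    (harch : N.IsHybridArchitecture) (hdiag : ∀ n, (n, n) ∈ N.pattern)
    (hfeas : N.StrictlyFeasible) {X : Matrix V V ℂ} {p : D → ℝ} {g d : V → Fin 2 → ℝ}
    (hopt : N.SOCOptimal X p g d) :
    ∃ L μ Z, N.DualFeasible L μ Z ∧ ∀ g' d' : V → Fin 2 → ℝ, (∀ n, g' n ∈ N.genSet n) →
      (∀ n, d' n ∈ N.loadSet n) →
      μ ⬝ᵥ N.ineqRhs + ∑ n, (N.benefit n (d' n) - L n ⬝ᵥ d' n)
        + ∑ n, (L n ⬝ᵥ g' n - N.cost n (g' n)) ≤ N.welfare g d := by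
  classical
  obtain ⟨L, μ, c, hmul⟩ := hopt.exists_multipliers hphys harch hdiag hfeas
  obtain ⟨hX, hg, hd, hbal, hineq, hpsd⟩ := hopt.1
  have hpsd' : ∀ k, (herm2 (N.branchCoord X k)).PosSemidef := fun k => by
    rw [N.herm2_branchCoord hX.1]
    exact hpsd k
  -- The perturbation of a limit may be increased without bound while the optimizer stays
  -- admissible; likewise below for adding a positive semidefinite matrix to a branch block.
  have hμ : ∀ m, 0 ≤ μ m := fun m => by
    refine nonneg_of_forall_nonneg_add_mul
      (a := μ ⬝ᵥ fun m => N.ineqLhs X p m - N.ineqRhs m) fun R hR => ?_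
    have := hmul 0 0 ((fun m => N.ineqLhs X p m - N.ineqRhs m) + Pi.single m R) 0
      ⟨X, p, g, d, hX, hg, hd, by simp, fun n => by simp [hbal], fun m' => ?_,
        fun k => by simpa using hpsd' k⟩
    · simpa [dotProduct_add, mul_comm] using this
    · have : 0 ≤ (Pi.single m R : IneqIdx V E D → ℝ) m' := by
        rw [Pi.single_apply]
        split_ifs <;> simp [hR]
      simpa using this
  have hc : ∀ k q, (herm2 q).PosSemidef → 0 ≤ c k ⬝ᵥ q := fun k q hq => by
    refine nonneg_of_forall_nonneg_add_mul
      (a := μ ⬝ᵥ fun m => N.ineqLhs X p m - N.ineqRhs m) fun R hR => ?_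
    have := hmul 0 0 (fun m => N.ineqLhs X p m - N.ineqRhs m) (Pi.single k (R • q))
      ⟨X, p, g, d, hX, hg, hd, by simp, fun n => by simp [hbal], fun m' => le_rfl,
        fun k' => ?_⟩
    · rw [Finset.sum_eq_single k (fun k' _ hk' => by simp [hk']) (by simp)] at this
      simpa [dotProduct_smul] using this
    · rw [herm2_add]
      refine (hpsd' k').add ?_
      rcases eq_or_ne k' k with rfl | hk'
      · simpa [herm2_smul] using hq.smul hR
      · rw [posSemidef_herm2_iff]
        simp [hk']
  -- The Lagrangian bound at an arbitrary point, feasible or not: the perturbation is chosen to make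
  -- every constraint tight, the branch blocks becoming zero.
  have hmain : ∀ X' (p' : D → ℝ) (g' d' : V → Fin 2 → ℝ), N.IsPartial X' →
      (∀ n, g' n ∈ N.genSet n) → (∀ n, d' n ∈ N.loadSet n) →
      N.welfare g' d' - N.welfare g d + ∑ n, L n ⬝ᵥ (g' n - d' n) + μ ⬝ᵥ N.ineqRhs ≤
        ((N.dualMat L μ - ∑ k, N.selMat k * herm2Dual (c k) * (N.selMat k)ᵀ) * X').trace.re
          + N.dualVec L μ ⬝ᵥ p' := fun X' p' g' d' hX' hg' hd' => by
    have := hmul (N.welfare g' d' - N.welfare g d) (fun n => N.injection X' p' n - (g' n - d' n))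
      (fun m => N.ineqLhs X' p' m - N.ineqRhs m) (fun k => -N.branchCoord X' k)
      ⟨X', p', g', d', hX', hg', hd', le_rfl, fun _ => rfl, fun _ => le_rfl, fun k => by
        rw [posSemidef_herm2_iff]
        simp⟩
    have h1 := N.sum_dotProduct_injection_add L μ X' p'
    have h2 := N.sum_dotProduct_branchCoord c hX'.1
    have h3 : (μ ⬝ᵥ fun m => N.ineqLhs X' p' m - N.ineqRhs m) =
        ∑ m, μ m * N.ineqLhs X' p' m - μ ⬝ᵥ N.ineqRhs := by
      simp only [dotProduct, mul_sub, Finset.sum_sub_distrib]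
    rw [h3] at this
    simp only [dotProduct_sub _ (N.injection X' p' _), Finset.sum_sub_distrib, dotProduct_neg,
      Finset.sum_neg_distrib] at this
    rw [Matrix.sub_mul, Matrix.trace_sub, Complex.sub_re]
    linarith
  set M := N.dualMat L μ - ∑ k, N.selMat k * herm2Dual (c k) * (N.selMat k)ᵀ with hM
  have hMpart : N.IsPartial M := by
    refine ⟨(N.dualMat_isHermitian L μ).sub (isHermitian_sum _ fun k =>
      N.selMat_mul_mul_isHermitian k (herm2_isHermitian _)), fun a b hab => ?_⟩
    rw [hM, Matrix.sub_apply, N.dualMat_apply_eq_zero hdiag L μ hab, Matrix.sum_apply,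
      Finset.sum_eq_zero fun k _ => N.selMat_mul_mul_eq_zero _ fun hk => hab ⟨k, hk⟩, sub_zero]
  -- The right side of `hmain` is linear in X' and p' and bounded below, so both coefficients
  -- vanish. For X' = RM, which is itself partial, the pairing is R times the squared Frobenius norm
  -- of M.
  have hM0 : M = 0 := by
    have h1 : (M * M).trace.re = 0 := eq_zero_of_forall_le_mul fun R => by
      have := hmain (R • M + (0 : ℝ) • 0) 0 g d (hMpart.comb N.isPartial_zero R 0) hg hd
      simpa using this
    have h2 : (Mᴴ * M).trace = 0 := by
      have h3 := (Matrix.posSemidef_conjTranspose_mul_self M).trace_nonneg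
      rw [hMpart.1.eq] at h3 ⊢
      exact Complex.ext h1 (Complex.le_def.1 h3).2.symm
    exact Matrix.trace_conjTranspose_mul_self_eq_zero_iff.1 h2
  have hvec : N.dualVec L μ = 0 := by
    refine dotProduct_self_eq_zero.1 (eq_zero_of_forall_le_mul
      (a := ∑ n, L n ⬝ᵥ (g n - d n) + μ ⬝ᵥ N.ineqRhs) fun R => ?_)
    have := hmain 0 (R • N.dualVec L μ) g d N.isPartial_zero hg hd
    rw [dotProduct_smul, smul_eq_mul] at this
    simpa using this
  refine ⟨L, μ, fun k => herm2Dual (c k), ⟨hμ, sub_eq_zero.1 hM0, hvec, fun k =>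
    posSemidef_herm2Dual _ (hc k)⟩, fun g' d' hg' hd' => ?_⟩
  have := hmain 0 0 g' d' N.isPartial_zero hg' hd'
  simp only [welfare, dotProduct_sub, Finset.sum_sub_distrib, mul_zero, Matrix.trace_zero,
    Complex.zero_re, dotProduct_zero, add_zero] at this ⊢
  linarith

end HybridGrid

/-! ### Rank-one completion on a tree, and the duality gap. -/

namespace HybridGrid

/-- A partial matrix with positive diagonal and singular principal submatrices on a tree has a
positive semidefinite completion of rank one. -/
theorem IsHybridArchitecture.hasRankOneCompletion {V E D : Type*} [Fintype V] [DecidableEq V]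
    {N : HybridGrid V E D} (harch : N.IsHybridArchitecture) {X : Matrix V V ℂ}
    (hX : X.IsHermitian) (hpos : ∀ n, 0 < (X n n).re) (hdet : ∀ k, (N.branchMat k X).det = 0) :
    N.HasRankOneCompletion X := by
  set G := SimpleGraph.fromEdgeSet (Set.range fun k => s(N.acSrc k, N.acDst k))
  have hne : ∀ n, X n n ≠ 0 := fun n h => by simpa [h] using hpos n
  have hreal : ∀ n, ((X n n).re : ℂ) = X n n := fun n => Complex.conj_eq_iff_re.1 (hX.apply n n)
  have hdet' : ∀ k, X (N.acSrc k) (N.acSrc k) * X (N.acDst k) (N.acDst k) =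
      X (N.acSrc k) (N.acDst k) * X (N.acDst k) (N.acSrc k) := fun k => by
    have := hdet k
    rw [Matrix.det_fin_two, sub_eq_zero] at this
    simpa [branchMat_apply] using this
  have hadj : ∀ u w, G.Adj u w → X u u * X w w = X u w * X w u := by
    rintro u w ⟨⟨k, hk⟩, -⟩
    rcases Sym2.eq_iff.1 hk with ⟨rfl, rfl⟩ | ⟨rfl, rfl⟩
    · exact hdet' k
    · rw [mul_comm, hdet' k, mul_comm]
  have hadj0 : ∀ u w, G.Adj u w → X u w ≠ 0 := fun u w h h0 => by
    have := hadj u w h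
    rw [h0, zero_mul] at this
    exact mul_ne_zero (hne u) (hne w) this
  classical
  -- For X = v vᴴ the label is the voltage ratio v_w / v_u; singularity of the block makes the
  -- reverse label its inverse. The value 1 is never used on an edge.
  obtain ⟨φ, hφ⟩ := harch.isTree.exists_potential
    (fun u w => if h : X w u ≠ 0 then Units.mk0 (X w u / X u u) (div_ne_zero h (hne u)) else 1)
    fun u w h => by
      rw [dif_pos (hadj0 u w h), dif_pos (hadj0 w u h.symm)]
      ext
      rw [Units.val_inv_eq_inv_val, Units.val_mk0, Units.val_mk0, inv_div, div_eq_div_iff (hne w)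
        (hadj0 w u h.symm), ← hadj u w h]
  have hφ' : ∀ u w, G.Adj u w → (φ w : ℂ) * X u u = φ u * X w u := fun u w h => by
    rw [hφ u w h, dif_pos (hadj0 w u h.symm), Units.val_mul, Units.val_mk0, mul_assoc,
      div_mul_cancel₀ _ (hne u)]
  have hsq : ∀ u w, G.Adj u w →
      (φ w : ℂ) * conj (φ w : ℂ) * X u u = φ u * conj (φ u : ℂ) * X w w := fun u w h => by
    have h1 := hφ' u w h
    have h2 := congrArg conj h1
    have h3 : conj (X u u) = X u u := hX.apply u u
    have h4 : conj (X w u) = X u w := hX.apply u w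
    rw [map_mul, map_mul, h3, h4] at h2
    refine mul_right_cancel₀ (hne u) ?_
    linear_combination conj (φ w : ℂ) * X u u * h1 + φ u * X w u * h2
      - φ u * conj (φ u : ℂ) * hadj u w h
  obtain ⟨r⟩ := harch.isTree.connected.nonempty
  -- The quotient |φ_n|² / X_nn agrees across each edge, hence is constant by connectedness. Its
  -- value κ is the scaling that turns φ into the voltage vector φ / √κ.
  have hconst : ∀ n, (φ n : ℂ) * conj (φ n : ℂ) * X r r = φ r * conj (φ r : ℂ) * X n n := by
    intro n
    obtain ⟨q⟩ := harch.isTree.connected.preconnected n r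
    induction q with
    | nil => rfl
    | @cons a b r h q ih =>
      refine mul_right_cancel₀ (hne b) ?_
      linear_combination X a a * ih - X r r * hsq a b h
  have hκ : 0 < Complex.normSq (φ r) / (X r r).re :=
    div_pos (Complex.normSq_pos.2 (φ r).ne_zero) (hpos r)
  set κ := Complex.normSq (φ r) / (X r r).re with hκdef
  have hκ' : (κ : ℂ) * X r r = φ r * conj (φ r : ℂ) := by
    rw [Complex.mul_conj, ← hreal r, ← Complex.ofReal_mul, hκdef, div_mul_cancel₀ _ (hpos r).ne']
  have hκ0 : (κ : ℂ) ≠ 0 := Complex.ofReal_ne_zero.2 hκ.ne'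
  have hdiag : ∀ n, (φ n : ℂ) * conj (φ n : ℂ) = κ * X n n := fun n => by
    refine mul_right_cancel₀ (hne r) ?_
    rw [hconst, ← hκ']
    ring
  have hedge : ∀ u w, G.Adj u w → (φ u : ℂ) * conj (φ w : ℂ) = κ * X u w := fun u w h => by
    refine mul_right_cancel₀ (hne w) ?_
    linear_combination conj (φ w : ℂ) * hφ' w u h.symm + X u w * hdiag w
  set z : V → ℂ := fun n => φ n / (Real.sqrt κ : ℂ)
  have hz : ∀ a b, Matrix.vecMulVec z (star z) a b = φ a * conj (φ b : ℂ) / κ := fun a b => by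
    have : ((Real.sqrt κ : ℝ) : ℂ) * (Real.sqrt κ : ℝ) = κ := by
      rw [← Complex.ofReal_mul, Real.mul_self_sqrt hκ.le]
    simp only [Matrix.vecMulVec_apply, Pi.star_apply, z, Complex.star_def, map_div₀,
      Complex.conj_ofReal, div_mul_div_comm, this]
  refine ⟨Matrix.vecMulVec z (star z), Matrix.posSemidef_vecMulVec_self_star z, ?_, ?_⟩
  · refine le_antisymm (Matrix.rank_vecMulVec_le _ _)
      (Nat.one_le_iff_ne_zero.2 (Matrix.rank_ne_zero fun h0 => ?_))
    have := hz r r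
    rw [h0, hdiag r, mul_div_cancel_left₀ _ hκ0] at this
    exact hne r this.symm
  · rintro a b ⟨k, ha, hb⟩
    have hk : G.Adj (N.acSrc k) (N.acDst k) :=
      (SimpleGraph.fromEdgeSet_adj _).2 ⟨⟨k, rfl⟩, harch.no_loop k⟩
    rw [hz, div_eq_iff hκ0, mul_comm _ (κ : ℂ)]
    rcases ha with rfl | rfl <;> rcases hb with rfl | rfl
    · exact hdiag _
    · exact hedge _ _ hk
    · exact hedge _ _ hk.symm
    · exact hdiag _

variable {V E D : Type*} [Fintype V] [DecidableEq V] [Fintype E] [Fintype D] [DecidableEq D]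
  {N : HybridGrid V E D}

theorem SOCFeasible.diag_pos (hphys : N.IsPhysical) {X : Matrix V V ℂ} {p : D → ℝ}
    {g d : V → Fin 2 → ℝ} (h : N.SOCFeasible X p g d) (n : V) : 0 < (X n n).re := by
  have h1 := h.ineq (.inl (n, 0))
  have h2 := pow_pos (hphys.vMin_pos n) 2
  simp [ineqLhs, ineqMat, ineqVec, ineqRhs, Matrix.trace_single_mul] at h1
  linarith

/-- At a bus without a branch the partial matrix would vanish, against the lower voltage limit.
Feasibility thus rules out the one-bus tree. -/
theorem SOCFeasible.diag_mem_pattern (hphys : N.IsPhysical) {X : Matrix V V ℂ} {p : D → ℝ}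
    {g d : V → Fin 2 → ℝ} (h : N.SOCFeasible X p g d) (n : V) : (n, n) ∈ N.pattern := by
  by_contra hn
  have := h.diag_pos hphys n
  rw [h.isPartial.2 n n hn] at this
  exact lt_irrefl _ this

/-- The consumer's surplus and the producer's profit are suprema of sets that are bounded above. -/
theorem bddAbove_surplus_profit (hphys : N.IsPhysical) (harch : N.IsHybridArchitecture)
    (hfeas : N.StrictlyFeasible) {X : Matrix V V ℂ} {p : D → ℝ} {g d : V → Fin 2 → ℝ}
    (hopt : N.SOCOptimal X p g d) (n : V) (l : Fin 2 → ℝ) :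
    BddAbove ((fun d => N.benefit n d - l ⬝ᵥ d) '' N.loadSet n) ∧
      BddAbove ((fun g => l ⬝ᵥ g - N.cost n g) '' N.genSet n) := by
  -- At the multipliers `L`, varying the load or generation of bus `n` alone in `hle` gives the
  -- bound. Passing from `L n` to `l` adds a linear function, bounded on the compact range.
  obtain ⟨L, μ, Z, -, hle⟩ := hopt.exists_dualFeasible hphys harch
    (hopt.1.diag_mem_pattern hphys) hfeas
  have hlin : ∀ (c : Fin 2 → ℝ) {S : Set (Fin 2 → ℝ)}, IsCompact S →
      ∃ K, ∀ x ∈ S, c ⬝ᵥ x ≤ K := fun c S hS => by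
    have hc : Continuous fun x : Fin 2 → ℝ => c ⬝ᵥ x := by fun_prop
    obtain ⟨K, hK⟩ := hS.bddAbove_image hc.continuousOn
    exact ⟨K, fun x hx => hK ⟨x, hx, rfl⟩⟩
  have hmem : ∀ {S : V → Set (Fin 2 → ℝ)} {x : V → Fin 2 → ℝ}, (∀ m, x m ∈ S m) →
      ∀ y ∈ S n, ∀ m, Function.update x n y m ∈ S m := fun {S x} hx y hy m => by
    rcases eq_or_ne m n with rfl | hm
    · simpa using hy
    · simpa [hm] using hx m
  constructor
  · obtain ⟨K, hK⟩ := hlin (L n - l) (hphys.loadSet_compact n)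
    refine ⟨N.welfare g d - μ ⬝ᵥ N.ineqRhs - ∑ n, (L n ⬝ᵥ g n - N.cost n (g n))
      - ∑ m ∈ Finset.univ.erase n, (N.benefit m (d m) - L m ⬝ᵥ d m) + K, ?_⟩
    rintro _ ⟨y, hy, rfl⟩
    have h1 := hle g (Function.update d n y) hopt.1.gen_mem (hmem hopt.1.load_mem y hy)
    rw [← Finset.add_sum_erase _ _ (Finset.mem_univ n), Function.update_self,
      Finset.sum_congr rfl fun m hm => by
        rw [Function.update_of_ne (Finset.ne_of_mem_erase hm)]] at h1
    have h2 := hK y hy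
    rw [sub_dotProduct] at h2
    simp only
    linarith
  · obtain ⟨K, hK⟩ := hlin (l - L n) (hphys.genSet_compact n)
    refine ⟨N.welfare g d - μ ⬝ᵥ N.ineqRhs - ∑ n, (N.benefit n (d n) - L n ⬝ᵥ d n)
      - ∑ m ∈ Finset.univ.erase n, (L m ⬝ᵥ g m - N.cost m (g m)) + K, ?_⟩
    rintro _ ⟨y, hy, rfl⟩
    have h1 := hle (Function.update g n y) d (hmem hopt.1.gen_mem y hy) hopt.1.load_mem
    rw [← Finset.add_sum_erase _ (fun m => L m ⬝ᵥ Function.update g n y m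
      - N.cost m (Function.update g n y m)) (Finset.mem_univ n), Function.update_self,
      Finset.sum_congr (s₁ := Finset.univ.erase n) rfl fun m hm => by
        rw [Function.update_of_ne (Finset.ne_of_mem_erase hm)]] at h1
    have h2 := hK y hy
    rw [sub_dotProduct] at h2
    simp only
    linarith

/-- The optimal value of the dual does not exceed that of the relaxation. -/
theorem DualOptimal.dualObj_le_welfare (hphys : N.IsPhysical) (harch : N.IsHybridArchitecture)
    (hfeas : N.StrictlyFeasible) {X : Matrix V V ℂ} {p : D → ℝ} {g d : V → Fin 2 → ℝ}
    (hopt : N.SOCOptimal X p g d) {L : V → Fin 2 → ℝ} {μ : IneqIdx V E D → ℝ}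
    {Z : E → Matrix (Fin 2) (Fin 2) ℂ} (hdual : N.DualOptimal L μ Z) :
    N.dualObj L μ ≤ N.welfare g d := by
  obtain ⟨L', μ', Z', hfeas', hle⟩ := hopt.exists_dualFeasible hphys harch
    (hopt.1.diag_mem_pattern hphys) hfeas
  refine (hdual.2 L' μ' Z' hfeas').trans ?_
  -- The bound `hle` is joint in generation and load, so the suprema are taken in turn: over g' for
  -- fixed d', then over d'.
  have hprofit : ∀ d' : V → Fin 2 → ℝ, (∀ n, d' n ∈ N.loadSet n) →
      ∑ n, N.profit n (L' n) ≤ N.welfare g d - μ' ⬝ᵥ N.ineqRhs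
        - ∑ n, (N.benefit n (d' n) - L' n ⬝ᵥ d' n) := fun d' hd' => by
    refine Finset.sum_csSup_le _ _ (fun n _ => (hphys.genSet_nonempty n).image _) _ fun x hx => ?_
    choose g' hg' hgx using fun n => hx n (Finset.mem_univ n)
    have := hle g' d' hg' hd'
    simp only [← hgx]
    linarith
  have hsurplus : ∑ n, N.surplus n (L' n) ≤ N.welfare g d - μ' ⬝ᵥ N.ineqRhs
      - ∑ n, N.profit n (L' n) := by
    refine Finset.sum_csSup_le _ _ (fun n _ => (hphys.loadSet_nonempty n).image _) _ fun x hx => ?_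
    choose d' hd' hdx using fun n => hx n (Finset.mem_univ n)
    have := hprofit d' hd'
    simp only [← hdx]
    linarith
  rw [dualObj]
  linarith

/-- Weak duality, with the contribution of the conic constraints to the duality gap. -/
theorem DualFeasible.sum_trace_le {L : V → Fin 2 → ℝ} {μ : IneqIdx V E D → ℝ}
    {Z : E → Matrix (Fin 2) (Fin 2) ℂ} (hdual : N.DualFeasible L μ Z) {X : Matrix V V ℂ}
    {p : D → ℝ} {g d : V → Fin 2 → ℝ} (h : N.SOCFeasible X p g d)
    (hbdd : ∀ n, BddAbove ((fun d => N.benefit n d - L n ⬝ᵥ d) '' N.loadSet n) ∧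
      BddAbove ((fun g => L n ⬝ᵥ g - N.cost n g) '' N.genSet n)) :
    ∑ k, (Z k * N.branchMat k X).trace.re ≤ N.dualObj L μ - N.welfare g d := by
  have h1 := N.sum_dotProduct_injection_add L μ X p
  have h2 : (N.dualMat L μ * X).trace.re = ∑ k, (Z k * N.branchMat k X).trace.re := by
    rw [hdual.dualMat_eq, Finset.sum_mul, Matrix.trace_sum, Complex.re_sum]
    simp only [trace_selMat_mul_mul_mul]
  rw [hdual.dualVec_eq, zero_dotProduct, add_zero, h2] at h1
  have h3 : ∑ m, μ m * N.ineqLhs X p m ≤ μ ⬝ᵥ N.ineqRhs :=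
    Finset.sum_le_sum fun m _ => mul_le_mul_of_nonneg_left (h.ineq m) (hdual.nonneg m)
  have h4 : ∑ n, (N.benefit n (d n) - L n ⬝ᵥ d n) ≤ ∑ n, N.surplus n (L n) :=
    Finset.sum_le_sum fun n _ => le_csSup (hbdd n).1 ⟨d n, h.load_mem n, rfl⟩
  have h5 : ∑ n, (L n ⬝ᵥ g n - N.cost n (g n)) ≤ ∑ n, N.profit n (L n) :=
    Finset.sum_le_sum fun n _ => le_csSup (hbdd n).2 ⟨g n, h.gen_mem n, rfl⟩
  simp only [h.balance, dotProduct_sub, Finset.sum_sub_distrib] at h1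
  rw [Finset.sum_sub_distrib] at h4 h5
  rw [dualObj, welfare]
  linarith

end HybridGrid
end

/-! ### Complementary slackness and exactness. -/

theorem mainTheorem3 {V E D : Type*} [Fintype V] [DecidableEq V] [Fintype E] [Fintype D]
    [DecidableEq D] (N : HybridGrid V E D) (hphys : N.IsPhysical) (harch : N.IsHybridArchitecture)
    (hfeas : N.StrictlyFeasible)
    (X : Matrix V V ℂ) (p : D → ℝ) (g d : V → Fin 2 → ℝ) (hprimal : N.SOCOptimal X p g d)
    (L : V → Fin 2 → ℝ) (μ : IneqIdx V E D → ℝ) (Z : E → Matrix (Fin 2) (Fin 2) ℂ)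
    (hdual : N.DualOptimal L μ Z)
    (hactive : ∀ n, 0 < L n 0) (hreactive : ∀ n, 0 ≤ L n 1) :
    (∀ k, (N.branchMat k X).rank = 1) ∧ N.SOCExact := by
  have hgap := hdual.1.sum_trace_le hprimal.1 fun n =>
    HybridGrid.bddAbove_surplus_profit hphys harch hfeas hprimal n (L n)
  have hle := hdual.dualObj_le_welfare hphys harch hfeas hprimal
  have hnonneg : ∀ k ∈ Finset.univ, 0 ≤ (Z k * N.branchMat k X).trace.re := fun k _ =>
    trace_mul_re_nonneg_of_posSemidef (hdual.1.psd k) (hprimal.1.psd k)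
  -- Nonnegative terms whose sum is at most the duality gap, which is nonpositive by strong duality.
  have hzero : ∀ k, (Z k * N.branchMat k X).trace.re = 0 := fun k =>
    (Finset.sum_eq_zero_iff_of_nonneg hnonneg).1
      (le_antisymm (hgap.trans (sub_nonpos.2 hle)) (Finset.sum_nonneg hnonneg)) k
      (Finset.mem_univ k)
  have hdet : ∀ k, (N.branchMat k X).det = 0 := fun k => by
    refine det_eq_zero_of_trace_mul_re_eq_zero (hdual.1.psd k) (hprimal.1.psd k) (hzero k) ?_
    rw [← HybridGrid.sum_selMat_mul_mul_src_dst harch Z k, ← hdual.1.dualMat_eq]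
    exact HybridGrid.dualMat_src_dst_ne_zero hphys harch L μ hdual.1.nonneg hactive hreactive k
  have hpos := hprimal.1.diag_pos hphys
  refine ⟨fun k => Matrix.rank_eq_one_of_det_eq_zero (hdet k) fun h0 => ?_, X, p, g, d, hprimal,
    harch.hasRankOneCompletion hprimal.1.isPartial.1 hpos hdet⟩
  have h00 : N.branchMat k X 0 0 = X (N.acSrc k) (N.acSrc k) := N.branchMat_apply k X 0 0
  have hlt := hpos (N.acSrc k)
  rw [← h00, h0] at hlt
  exact lt_irrefl _ hlt
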